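/- Let $\mathsf k$ be a field and let $I\subseteq \mathsf k[x,y]$ be a monomial ideal that is not principal. Identify $x^ay^b$ with $(a,b)\in\mathbb N_0^2$. For a monomial ideal $J$ let $G(J)$ be its set of minimal monomial generators, $\mu(J)=|G(J)|$, and for $\bullet\in\{x,y\}$ let $\operatorname{dist}_\bullet J=\max_{g\in G(J)}\deg_\bullet g-\min_{g\in G(J)}\deg_\bullet g$; for monomials $g,h$ let $\operatorname{dist}_\bullet(g,h)=|\deg_\bullet g-\deg_\bullet h|$. Let $P(I)$ be the set of persistent generators, i.e. of those $f\in G(I)$ such that for all monomials $g,h\in I\setminus\{f\}$ and all $n\ge 1$ one has $f^n\notin (g,h)^n$, and let $P^*(I)$ be the set of weakly persistent generators, i.e. of those $f\in G(I)$ with $f^n\in G(I^n)$ for all $n\ge1$. Let $P=\{g_1,\dots,g_{k+1}\}$, with the $g_i$ in descending $y$-degree, be a set with $P(I)\subseteq P\subseteq P^*(I)$. Put $$\delta_P=\max_{1\le i\le k}\min\{\operatorname{dist}_x(g_i,g_{i+1}),\operatorname{dist}_y(g_i,g_{i+1})\}-1,\qquad d_P=\begin{cases}\min\{\operatorname{dist}_xI,\operatorname{dist}_yI\}-2,&|P|>2,\\0,&|P|=2,\end{cases}$$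 $$D_P=(\mu(I)-|P|)\,\delta_P+|P|\,d_P,\qquad r_\bullet(P,D)=\Big\lceil D\cdot\max_{1\le i\le k}\frac{\operatorname{dist}_\bullet I}{\operatorname{dist}_\bullet(g_i,g_{i+1})}\Big\rceil,\qquad r(P,D)=\min\{r_x(P,D),r_y(P,D)\}.$$ Consider machines with finitely many registers holding natural numbers and finitely many stacks of natural numbers, whose instructions are: load a constant, copy a register, add two registers, push, pop, read the height of a stack, branch on a comparison $\le$ of two registers, and repeat a block as often as the value of a register on entry; every instruction, comparison, loop entry and round of a loop is one step. There is one program, independent of $\mathsf k$, $I$, $P$, $s$ and $\ell$, such that for every $\mathsf k$, $I$ and $P$ as above and every $s\ge D_P+r(P,D_P)+1$ there is a constant $C$ such that for all $\ell\ge0$ the program, given the exponents of the elements of $G(I^s)$ and of $P$ (each listed in descending $y$-degree) and the number $\ell$, computes the list of the exponents of the elements of $G(I^{s+\ell})$ (in descending $y$-degree) with at most $C\ell$ additions and at most $C(\ell+1)$ steps in total. In particular, $G(I^{s+\ell})$ can be computed from $G(I^s)$ with $\mathcal O(\ell)$ additions of monomial exponents. -/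

import Mathlib

universe u

noncomputable section

/-! ### Monomial ideals in two variables

A monomial `x ^ a * y ^ b` is identified with its pair of exponents `(a, b) : ℕ × ℕ`.
Divisibility of monomials is the componentwise order on `ℕ × ℕ`, and multiplication of monomials
is addition of pairs. -/

/-- The polynomial ring in two variables over `K`. -/
abbrev Poly2 (K : Type u) [Field K] : Type u := MvPolynomial (Fin 2) K

/-- The monomial `x ^ p.1 * y ^ p.2`. -/
def mon (K : Type u) [Field K] (p : ℕ × ℕ) : Poly2 K :=
  MvPolynomial.X 0 ^ p.1 * MvPolynomial.X 1 ^ p.2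

/-- An ideal is monomial if it is generated by a set of monomials. -/
def IsMonomialIdeal {K : Type u} [Field K] (I : Ideal (Poly2 K)) : Prop :=
  ∃ E : Set (ℕ × ℕ), I = Ideal.span (mon K '' E)

/-- The (exponents of the) minimal monomial generators of a monomial ideal `I`: the monomials of
`I` that are minimal with respect to divisibility. -/
def mingens {K : Type u} [Field K] (I : Ideal (Poly2 K)) : Set (ℕ × ℕ) :=
  {p | Minimal (fun q => mon K q ∈ I) p}

/-- The number `μ(I)` of minimal generators. -/
def numGens {K : Type u} [Field K] (I : Ideal (Poly2 K)) : ℕ := (mingens I).ncard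

/-- `f` lies in the integral closure of the ideal `(g, h)`: some positive power of `f` lies in
the same power of `(g, h)`. -/
def InClosurePair (K : Type u) [Field K] (g h f : ℕ × ℕ) : Prop :=
  ∃ n : ℕ, 0 < n ∧ mon K f ^ n ∈ (Ideal.span {mon K g, mon K h} : Ideal (Poly2 K)) ^ n

/-- The set `P(I)` of persistent generators. -/
def persistentGens {K : Type u} [Field K] (I : Ideal (Poly2 K)) : Set (ℕ × ℕ) :=
  {f | f ∈ mingens I ∧ ∀ g h : ℕ × ℕ, mon K g ∈ I → mon K h ∈ I → g ≠ f → h ≠ f →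
    ¬ InClosurePair K g h f}

/-- The set `P*(I)` of weakly persistent generators. -/
def weaklyPersistentGens {K : Type u} [Field K] (I : Ideal (Poly2 K)) : Set (ℕ × ℕ) :=
  {f | f ∈ mingens I ∧ ∀ n : ℕ, 0 < n → n • f ∈ mingens (I ^ n)}

/-- The list `L` consists of monomials ordered in strictly descending `y`-degree. -/
def DescY (L : List (ℕ × ℕ)) : Prop := L.Pairwise (fun p q => q.2 < p.2)

/-- `L` is the list of all minimal generators of `I`, in descending `y`-degree. -/
def ListsMingens {K : Type u} [Field K] (L : List (ℕ × ℕ)) (I : Ideal (Poly2 K)) : Prop :=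
  DescY L ∧ ∀ p : ℕ × ℕ, p ∈ L ↔ p ∈ mingens I

/-! ### The numerical invariants

In what follows `deg : ℕ × ℕ → ℕ` is one of the two degrees, `Prod.fst` (the `x`-degree) or
`Prod.snd` (the `y`-degree). -/

/-- The distance of a monomial ideal along a variable: the difference between the largest and the
smallest degree of a minimal generator, that is, the largest degree of a minimal generator after
the greatest common divisor has been divided out. -/
def distIdeal {K : Type u} [Field K] (deg : ℕ × ℕ → ℕ) (I : Ideal (Poly2 K)) : ℕ :=
  sSup (deg '' mingens I) - sInf (deg '' mingens I)

/-- The distance of two monomials along a variable. -/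
def distPair (deg : ℕ × ℕ → ℕ) (g h : ℕ × ℕ) : ℕ := max (deg g) (deg h) - min (deg g) (deg h)

/-- The pairs `(g₁, g₂), (g₂, g₃), …` of consecutive entries of a list. -/
def consecutive (P : List (ℕ × ℕ)) : List ((ℕ × ℕ) × (ℕ × ℕ)) := P.zip P.tail

/-- `δ_P = max_i min {dist_x (g_i, g_{i+1}), dist_y (g_i, g_{i+1})} - 1`. -/
def deltaP (P : List (ℕ × ℕ)) : ℕ :=
  ((consecutive P).map fun q =>
    min (distPair Prod.fst q.1 q.2) (distPair Prod.snd q.1 q.2)).foldr max 0 - 1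

/-- `d_P = min {dist_x I, dist_y I} - 2` if `|P| > 2`, and `d_P = 0` otherwise. -/
def dP {K : Type u} [Field K] (I : Ideal (Poly2 K)) (P : List (ℕ × ℕ)) : ℕ :=
  if 2 < P.length then min (distIdeal Prod.fst I) (distIdeal Prod.snd I) - 2 else 0

/-- `D_P = (μ(I) - |P|) * δ_P + |P| * d_P`. -/
def bigD {K : Type u} [Field K] (I : Ideal (Poly2 K)) (P : List (ℕ × ℕ)) : ℕ :=
  (numGens I - P.length) * deltaP P + P.length * dP I P

/-- `⌈D * max_i (dist I / dist (g_i, g_{i+1}))⌉`, the distances being taken along one variable. -/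
def rAlong {K : Type u} [Field K] (deg : ℕ × ℕ → ℕ) (I : Ideal (Poly2 K)) (P : List (ℕ × ℕ))
    (D : ℕ) : ℕ :=
  ⌈(D : ℚ) * ((consecutive P).map fun q =>
    (distIdeal deg I : ℚ) / (distPair deg q.1 q.2 : ℚ)).foldr max 0⌉₊

/-- `r(P, D) = min {r_x(P, D), r_y(P, D)}`. -/
def rMin {K : Type u} [Field K] (I : Ideal (Poly2 K)) (P : List (ℕ × ℕ)) (D : ℕ) : ℕ :=
  min (rAlong Prod.fst I P D) (rAlong Prod.snd I P D)

end

/-! ### The machine model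

A machine has registers, each holding a natural number, and stacks of natural numbers. Its only
arithmetic operation is the addition of two registers. Programs are finite, and loops are bounded:
the number of rounds is read off a register when the loop is entered. -/

/-- Programs. Registers and stacks are named by natural numbers. -/
inductive Prog : Type
  /-- `const r n`: put the literal `n` into register `r`. -/
  | const (r n : ℕ)
  /-- `copy r a`: copy register `a` into register `r`. -/
  | copy (r a : ℕ)
  /-- `add r a b`: put the sum of the registers `a` and `b` into register `r`. -/
  | add (r a b : ℕ)
  /-- `push t a`: push the value of register `a` onto stack `t`. -/
  | push (t a : ℕ)
  /-- `pop r t`: remove the top entry of stack `t` and put it into register `r`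
  (which becomes `0` if the stack is empty). -/
  | pop (r t : ℕ)
  /-- `len r t`: put the height of stack `t` into register `r`. -/
  | len (r t : ℕ)
  /-- `seq p q`: run `p`, then `q`. -/
  | seq (p q : Prog)
  /-- `ifLe a b p q`: run `p` if register `a` is at most register `b`, and `q` otherwise. -/
  | ifLe (a b : ℕ) (p q : Prog)
  /-- `loop a p`: run `p` as often as the value that register `a` has on entry. -/
  | loop (a : ℕ) (p : Prog)

/-- A state of the machine: the registers, the stacks (the head of a list is the top), the number
of additions carried out so far, and the number of steps of any kind carried out so far. -/
structure MState : Type where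
  /-- the registers -/
  reg : ℕ → ℕ
  /-- the stacks -/
  stk : ℕ → List ℕ
  /-- the number of additions so far -/
  adds : ℕ
  /-- the number of steps so far -/
  steps : ℕ

/-- Count one step. -/
def MState.tick (σ : MState) : MState := { σ with steps := σ.steps + 1 }

/-- Write `n` into register `r`. -/
def MState.setReg (σ : MState) (r n : ℕ) : MState := { σ with reg := Function.update σ.reg r n }

/-- Replace the contents of stack `t` by `l`. -/
def MState.setStk (σ : MState) (t : ℕ) (l : List ℕ) : MState :=
  { σ with stk := Function.update σ.stk t l }

/-- Count one addition. -/
def MState.countAdd (σ : MState) : MState := { σ with adds := σ.adds + 1 }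

/-- Run a program. Every basic instruction, every comparison, every entry into a loop and every
round of a loop costs one step; every `add` moreover counts as one addition. -/
def Prog.run : Prog → MState → MState
  | .const r n, σ => (σ.setReg r n).tick
  | .copy r a, σ => (σ.setReg r (σ.reg a)).tick
  | .add r a b, σ => (σ.setReg r (σ.reg a + σ.reg b)).countAdd.tick
  | .push t a, σ => (σ.setStk t (σ.reg a :: σ.stk t)).tick
  | .pop r t, σ => ((σ.setReg r ((σ.stk t).headD 0)).setStk t (σ.stk t).tail).tick
  | .len r t, σ => (σ.setReg r (σ.stk t).length).tick
  | .seq p q, σ => q.run (p.run σ)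
  | .ifLe a b p q, σ => if σ.reg a ≤ σ.reg b then p.run σ.tick else q.run σ.tick
  | .loop a p, σ => (fun τ : MState => p.run τ.tick)^[σ.reg a] σ.tick

/-- A list of monomials as a list of natural numbers: for each monomial its `x`-exponent, followed
by its `y`-exponent. -/
def encodeMons (L : List (ℕ × ℕ)) : List ℕ := L.flatMap fun p => [p.1, p.2]

/-- The initial state: the number `ℓ` in register `0`, the monomials `G` on stack `0`, the
monomials `P` on stack `1`, and everything else zero or empty. -/
def initState (G P : List (ℕ × ℕ)) (ℓ : ℕ) : MState where
  reg := fun r => if r = 0 then ℓ else 0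
  stk := fun t => if t = 0 then encodeMons G else if t = 1 then encodeMons P else []
  adds := 0
  steps := 0

/-! A monomial lies in `I ^ n` exactly when its exponent dominates a sum of `n` exponents of
generators, so everything happens with multisets of points in the plane. Two exchanges simplify such
a multiset without leaving the divisors of the given monomial. A generator `f` outside `P` lies on
or above the segment joining two consecutive elements `g`, `h` of `P`; hence some power `f ^ (a +
b)` with `a + b ≤ δ_P + 1` is divisible by `g ^ a * h ^ b` (`exists_combination_le`). This holds
because each weight needed is minimized over `I` at a persistent monomial, which belongs to `P`,
while weakly persistent generators never rise above a chord (`weight_le_of_consecutive`). An element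
`f` of `P` between two others `a`, `b` lies on or below their chord, so a suitable product of powers
of `a` and `b` may be replaced by a power of `f`. A multiset minimal for (number of factors outside
`P`, sum of squared degrees) admits neither exchange (`exists_reduced_product`). All but `D_P` of
its factors then belong to one consecutive pair (`exists_consecutive_count_le`), and for `s ≥ D_P`
this gives `I ^ (s + ℓ) = ∑ᵢ (gᵢ, gᵢ₊₁) ^ ℓ * I ^ s` (`mon_mem_pow_add_iff`).

The right-hand side is generated by segments of `ℓ + 1` monomials, one for each consecutive pair and
each generator of `I ^ s`. Each segment is already sorted by `x`-degree, and their number does not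
depend on `ℓ`. Merging them and keeping only the successive records of smallest `y`-degree
(`mem_skyline_iff_minimal`) lists the minimal generators in time linear in `ℓ`. -/

/-! ### Monomial ideals as sets of exponents -/

section Monomials

variable {K : Type u} [Field K]

/-- The exponent vector of `mon K p`. -/
noncomputable def expVec (p : ℕ × ℕ) : Fin 2 →₀ ℕ := Finsupp.single 0 p.1 + Finsupp.single 1 p.2

lemma expVec_le_iff {p q : ℕ × ℕ} : expVec p ≤ expVec q ↔ p ≤ q := by
  rw [Finsupp.le_def, Fin.forall_fin_two, Prod.le_def]
  simp [expVec]

lemma mon_eq_monomial (p : ℕ × ℕ) : mon K p = MvPolynomial.monomial (expVec p) 1 := by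
  simp [mon, expVec, MvPolynomial.X_pow_eq_monomial, MvPolynomial.monomial_mul]

lemma mon_add (p q : ℕ × ℕ) : mon K (p + q) = mon K p * mon K q := by
  simp only [mon, Prod.fst_add, Prod.snd_add, pow_add]
  ring

lemma mon_zero : mon K 0 = 1 := by simp [mon]

lemma mon_nsmul (n : ℕ) (p : ℕ × ℕ) : mon K (n • p) = mon K p ^ n := by
  simp only [mon, Prod.smul_fst, Prod.smul_snd, smul_eq_mul, mul_pow, ← pow_mul]
  ring

lemma mon_mem_span_iff {E : Set (ℕ × ℕ)} {p : ℕ × ℕ} :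
    mon K p ∈ Ideal.span (mon K '' E) ↔ ∃ e ∈ E, e ≤ p := by
  classical
  have h : mon K '' E = (fun v => MvPolynomial.monomial v (1 : K)) '' (expVec '' E) := by
    rw [Set.image_image]
    exact Set.image_congr fun p _ => mon_eq_monomial p
  rw [h, MvPolynomial.mem_ideal_span_monomial_image, mon_eq_monomial,
    MvPolynomial.support_monomial, if_neg one_ne_zero]
  simp [expVec_le_iff]

lemma mon_mem_of_le {I : Ideal (Poly2 K)} {p q : ℕ × ℕ} (hp : mon K p ∈ I) (hpq : p ≤ q) :
    mon K q ∈ I := by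
  obtain ⟨r, rfl⟩ := le_iff_exists_add.1 hpq
  rw [mon_add]
  exact I.mul_mem_right _ hp

/-- The sums of `n` elements of `E`. -/
def nSums (E : Set (ℕ × ℕ)) (n : ℕ) : Set (ℕ × ℕ) :=
  {p | ∃ m : Multiset (ℕ × ℕ), Multiset.card m = n ∧ (∀ q ∈ m, q ∈ E) ∧ m.sum = p}

lemma span_mon_pow (E : Set (ℕ × ℕ)) (n : ℕ) :
    Ideal.span (mon K '' E) ^ n = Ideal.span (mon K '' nSums E n) := by
  induction n with
  | zero =>
    have : nSums E 0 = {0} := by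
      ext p
      constructor
      · rintro ⟨m, hm, -, rfl⟩
        simp [Multiset.card_eq_zero.1 hm]
      · rintro rfl
        exact ⟨0, by simp⟩
    rw [pow_zero, this, Set.image_singleton, mon_zero, Ideal.span_singleton_one,
      Ideal.one_eq_top]
  | succ n ih =>
    rw [pow_succ, ih, Ideal.span_mul_span']
    congr 1
    ext f
    rw [Set.mem_mul]
    constructor
    · rintro ⟨_, ⟨p, ⟨m, hm, hmE, rfl⟩, rfl⟩, _, ⟨q, hq, rfl⟩, rfl⟩
      refine ⟨q + m.sum, ⟨q ::ₘ m, by simp [hm], ?_, by simp⟩, by rw [mon_add, mul_comm]⟩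
      intro r hr
      rcases Multiset.mem_cons.1 hr with rfl | hr
      exacts [hq, hmE r hr]
    · rintro ⟨p, ⟨m, hm, hmE, rfl⟩, rfl⟩
      obtain ⟨q, hq⟩ := Multiset.card_pos_iff_exists_mem.1 (by omega : 0 < Multiset.card m)
      obtain ⟨m, rfl⟩ := Multiset.exists_cons_of_mem hq
      refine ⟨_, ⟨m.sum, ⟨m, by simpa using hm, fun r hr => hmE r (by simp [hr]), rfl⟩, rfl⟩,
        _, ⟨q, hmE q hq, rfl⟩, ?_⟩
      rw [Multiset.sum_cons, mon_add, mul_comm]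

/-- Turns membership in a power into a statement about multisets of exponents, from which the field
has disappeared. -/
lemma mon_mem_span_pow_iff {E : Set (ℕ × ℕ)} {n : ℕ} {p : ℕ × ℕ} :
    mon K p ∈ Ideal.span (mon K '' E) ^ n ↔
      ∃ m : Multiset (ℕ × ℕ), Multiset.card m = n ∧ (∀ q ∈ m, q ∈ E) ∧ m.sum ≤ p := by
  rw [span_mon_pow, mon_mem_span_iff]
  constructor
  · rintro ⟨_, ⟨m, h1, h2, rfl⟩, h3⟩
    exact ⟨m, h1, h2, h3⟩
  · rintro ⟨m, h1, h2, h3⟩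
    exact ⟨_, ⟨m, h1, h2, rfl⟩, h3⟩

lemma mon_sum_mem_pow {I : Ideal (Poly2 K)} (m : Multiset (ℕ × ℕ))
    (h : ∀ q ∈ m, mon K q ∈ I) : mon K m.sum ∈ I ^ Multiset.card m := by
  induction m using Multiset.induction_on with
  | empty => simp
  | cons a m ih =>
    rw [Multiset.sum_cons, mon_add, Multiset.card_cons, pow_succ']
    exact Ideal.mul_mem_mul (h a (Multiset.mem_cons_self a m))
      (ih fun q hq => h q (Multiset.mem_cons_of_mem hq))

lemma exists_mingens_le {I : Ideal (Poly2 K)} {p : ℕ × ℕ} (hp : mon K p ∈ I) :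
    ∃ q ∈ mingens I, q ≤ p := by
  obtain ⟨q, hqp, hq⟩ := exists_minimal_le_of_wellFoundedLT (fun q => mon K q ∈ I) p hp
  exact ⟨q, hq, hqp⟩

lemma eq_span_mingens {I : Ideal (Poly2 K)} (hI : IsMonomialIdeal I) :
    I = Ideal.span (mon K '' mingens I) := by
  obtain ⟨E, hE⟩ := hI
  apply le_antisymm
  · nth_rw 1 [hE]
    rw [Ideal.span_le]
    rintro _ ⟨p, hp, rfl⟩
    have hpI : mon K p ∈ I := by
      rw [hE]
      exact Ideal.subset_span ⟨p, hp, rfl⟩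
    obtain ⟨q, hq, hqp⟩ := exists_mingens_le hpI
    exact mon_mem_span_iff.2 ⟨q, hq, hqp⟩
  · rw [Ideal.span_le]
    rintro _ ⟨p, hp, rfl⟩
    exact hp.1

/-- Dickson's lemma: minimal elements form an antichain in a well-quasi-order. -/
lemma finite_mingens (I : Ideal (Poly2 K)) : (mingens I).Finite := by
  apply WellQuasiOrderedLE.finite_of_isAntichain
  exact setOfPred_minimal_antichain _

lemma eq_of_mem_mingens_of_le {I : Ideal (Poly2 K)} {p q : ℕ × ℕ} (hp : p ∈ mingens I)
    (hq : mon K q ∈ I) (h : q ≤ p) : q = p :=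
  le_antisymm h (hp.2 hq h)

lemma sub_le_distIdeal {I : Ideal (Poly2 K)} (deg : ℕ × ℕ → ℕ) {p q : ℕ × ℕ}
    (hp : p ∈ mingens I) (hq : q ∈ mingens I) : deg p - deg q ≤ distIdeal deg I := by
  have h1 : deg p ≤ sSup (deg '' mingens I) :=
    le_csSup ((finite_mingens I).image deg).bddAbove ⟨p, hp, rfl⟩
  have h2 : sInf (deg '' mingens I) ≤ deg q := Nat.sInf_le ⟨q, hq, rfl⟩
  unfold distIdeal
  omega

end Monomials

/-! ### Weights, persistence and chords -/

section Persistence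

variable {K : Type u} [Field K] {I : Ideal (Poly2 K)}

/-- If every other monomial of `I` has weight at least `w + 1`, where `w` is the weight of `f`, then
a product of `n ≥ 1` of them has weight at least `n * (w + 1) > n * w` and cannot divide `f ^ n`. -/
lemma mem_persistentGens_of_unique_min {f : ℕ × ℕ} (A B : ℕ) (hf : mon K f ∈ I)
    (h : ∀ g, mon K g ∈ I → g ≠ f → A * f.1 + B * f.2 < A * g.1 + B * g.2) :
    f ∈ persistentGens I := by
  refine ⟨⟨hf, fun g hg hgf => ?_⟩, ?_⟩
  · by_contra hne
    have := h g hg (by rintro rfl; exact hne le_rfl)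
    have h1 := Nat.mul_le_mul_left A hgf.1
    have h2 := Nat.mul_le_mul_left B hgf.2
    omega
  · rintro g g' hg hg' hgf hgf' ⟨n, hn, hmem⟩
    rw [← mon_nsmul, ← Set.image_pair, mon_mem_span_pow_iff] at hmem
    obtain ⟨m, hcard, hm, hsum⟩ := hmem
    have key : ∀ m : Multiset (ℕ × ℕ), (∀ q ∈ m, q ∈ ({g, g'} : Set (ℕ × ℕ))) →
        Multiset.card m * (A * f.1 + B * f.2 + 1) ≤ A * m.sum.1 + B * m.sum.2 := by
      intro m hm
      induction m using Multiset.induction_on with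
      | empty => simp
      | cons a m ih =>
        have h1 := ih fun q hq => hm q (Multiset.mem_cons_of_mem hq)
        have h2 : A * f.1 + B * f.2 < A * a.1 + B * a.2 := by
          rcases hm a (Multiset.mem_cons_self a m) with rfl | rfl
          exacts [h _ hg hgf, h _ hg' hgf']
        simp only [Multiset.card_cons, Multiset.sum_cons, Prod.fst_add, Prod.snd_add]
        nlinarith
    have h1 := key m hm
    have h2 := Nat.mul_le_mul_left A hsum.1
    have h3 := Nat.mul_le_mul_left B hsum.2
    simp only [Prod.smul_fst, Prod.smul_snd, smul_eq_mul, hcard] at h1 h2 h3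
    nlinarith

/-- A monomial of `I` that minimizes a weight, ties being broken by a second independent weight,
exists and is persistent. -/
lemma exists_persistent_minimizing (A B C D : ℕ) (hdet : A * D ≠ B * C)
    (hI : ∃ p, mon K p ∈ I) :
    ∃ f ∈ persistentGens I, ∀ g, mon K g ∈ I →
      A * f.1 + B * f.2 < A * g.1 + B * g.2 ∨
        A * f.1 + B * f.2 = A * g.1 + B * g.2 ∧ C * f.1 + D * f.2 ≤ C * g.1 + D * g.2 := by
  obtain ⟨f, hf, hmin⟩ := exists_minimalFor_of_wellFoundedLT (fun p => mon K p ∈ I)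
    (fun p => toLex (A * p.1 + B * p.2, C * p.1 + D * p.2)) hI
  have hlex : ∀ g, mon K g ∈ I → A * f.1 + B * f.2 < A * g.1 + B * g.2 ∨
        A * f.1 + B * f.2 = A * g.1 + B * g.2 ∧ C * f.1 + D * f.2 ≤ C * g.1 + D * g.2 := by
    intro g hg
    rcases le_total (toLex (A * f.1 + B * f.2, C * f.1 + D * f.2))
      (toLex (A * g.1 + B * g.2, C * g.1 + D * g.2)) with h | h
    · exact Prod.Lex.toLex_le_toLex.1 h
    · exact Prod.Lex.toLex_le_toLex.1 (hmin hg h)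
  refine ⟨f, ?_, hlex⟩
  -- `N` exceeds the tie-breaking weight of `f`, so in comparisons with `f` the single weight `N *
  -- first + second` reproduces the lexicographic order.
  set N := C * f.1 + D * f.2 + 1 with hN
  apply mem_persistentGens_of_unique_min (N * A + C) (N * B + D) hf
  intro g hg hgf
  have e : ∀ p : ℕ × ℕ, (N * A + C) * p.1 + (N * B + D) * p.2
      = N * (A * p.1 + B * p.2) + (C * p.1 + D * p.2) := fun p => by ring
  rw [e, e]
  rcases hlex g hg with h | ⟨h1, h2⟩
  · have := Nat.mul_le_mul_left N (Nat.succ_le_of_lt h)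
    rw [Nat.mul_succ] at this
    omega
  · rw [h1]
    refine Nat.add_lt_add_left (lt_of_le_of_ne h2 fun h2 => hgf ?_) _
    zify at h1 h2 hdet
    -- Cramer's rule: two independent weights that agree on `f` and `g` force `f = g`.
    have hdet' : (A * D - B * C : ℤ) ≠ 0 := sub_ne_zero.2 hdet
    have e1 : (A * D - B * C : ℤ) * (g.1 - f.1) = 0 := by
      linear_combination (-D : ℤ) * h1 + B * h2
    have e2 : (A * D - B * C : ℤ) * (g.2 - f.2) = 0 := by
      linear_combination (-A : ℤ) * h2 + C * h1
    have e1 := (mul_eq_zero.1 e1).resolve_left hdet'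
    have e2 := (mul_eq_zero.1 e2).resolve_left hdet'
    ext <;> omega

/-- No combination of two monomials of `I` strictly divides the corresponding power of a weakly
persistent generator. -/
lemma eq_of_combination_le {f a b : ℕ × ℕ} (hf : f ∈ weaklyPersistentGens I)
    (ha : mon K a ∈ I) (hb : mon K b ∈ I) {i j : ℕ} (hij : 0 < i + j)
    (h : i • a + j • b ≤ (i + j) • f) : i • a + j • b = (i + j) • f := by
  refine eq_of_mem_mingens_of_le (hf.2 (i + j) hij) ?_ h
  rw [mon_add, mon_nsmul, mon_nsmul, pow_add]
  exact Ideal.mul_mem_mul (Ideal.pow_mem_pow ha i) (Ideal.pow_mem_pow hb j)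

/-- A weakly persistent generator lies on or below the chord of two monomials on its two sides. -/
lemma le_combination_fst {f a b : ℕ × ℕ} (hf : f ∈ weaklyPersistentGens I)
    (ha : mon K a ∈ I) (hb : mon K b ∈ I) (haf : a.1 < f.1) (hfb : f.1 < b.1) :
    (b.1 - a.1) • f ≤ (b.1 - f.1) • a + (f.1 - a.1) • b := by
  have hd : b.1 - a.1 = (b.1 - f.1) + (f.1 - a.1) := by omega
  -- These coefficients make the `x`-degrees agree, so the two sides are comparable; if the chord
  -- were the smaller one, weak persistence would force equality.
  have hx : ((b.1 - f.1) • a + (f.1 - a.1) • b).1 = ((b.1 - a.1) • f).1 := by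
    simp only [Prod.fst_add, Prod.smul_fst, smul_eq_mul]
    zify [haf.le, hfb.le, (haf.trans hfb).le]
    ring
  rcases le_total ((b.1 - a.1) • f).2 ((b.1 - f.1) • a + (f.1 - a.1) • b).2 with h | h
  · exact ⟨hx.ge, h⟩
  · have hle : (b.1 - f.1) • a + (f.1 - a.1) • b ≤ (b.1 - a.1) • f := ⟨hx.le, h⟩
    rw [hd] at hle ⊢
    exact (eq_of_combination_le hf ha hb (by omega) hle).ge

lemma le_combination_snd {f a b : ℕ × ℕ} (hf : f ∈ weaklyPersistentGens I)
    (ha : mon K a ∈ I) (hb : mon K b ∈ I) (haf : a.2 < f.2) (hfb : f.2 < b.2) :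
    (b.2 - a.2) • f ≤ (b.2 - f.2) • a + (f.2 - a.2) • b := by
  have hd : b.2 - a.2 = (b.2 - f.2) + (f.2 - a.2) := by omega
  have hx : ((b.2 - f.2) • a + (f.2 - a.2) • b).2 = ((b.2 - a.2) • f).2 := by
    simp only [Prod.snd_add, Prod.smul_snd, smul_eq_mul]
    zify [haf.le, hfb.le, (haf.trans hfb).le]
    ring
  rcases le_total ((b.2 - a.2) • f).1 ((b.2 - f.2) • a + (f.2 - a.2) • b).1 with h | h
  · exact ⟨h, hx.ge⟩
  · have hle : (b.2 - f.2) • a + (f.2 - a.2) • b ≤ (b.2 - a.2) • f := ⟨h, hx.le⟩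
    rw [hd] at hle ⊢
    exact (eq_of_combination_le hf ha hb (by omega) hle).ge

end Persistence

/-! ### Auxiliary facts on lists and multisets -/

section Lists

lemma le_foldr_max {l : List ℕ} {a : ℕ} (h : a ∈ l) : a ≤ l.foldr max 0 := by
  induction l with
  | nil => simp at h
  | cons b l ih =>
    rcases List.mem_cons.1 h with rfl | h
    · exact le_max_left _ _
    · exact (ih h).trans (le_max_right _ _)

lemma mem_consecutive {P : List (ℕ × ℕ)} {i : ℕ} (hi : i + 1 < P.length) :
    (P[i], P[i + 1]) ∈ consecutive P := by
  rw [consecutive, List.mem_iff_getElem]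
  exact ⟨i, by simp; omega, by simp⟩

lemma min_distPair_le_deltaP {P : List (ℕ × ℕ)} {i : ℕ} (hi : i + 1 < P.length) :
    min (distPair Prod.fst P[i] P[i + 1]) (distPair Prod.snd P[i] P[i + 1]) ≤ deltaP P + 1 := by
  have := le_foldr_max (List.mem_map_of_mem (f := fun q : (ℕ × ℕ) × (ℕ × ℕ) =>
    min (distPair Prod.fst q.1 q.2) (distPair Prod.snd q.1 q.2)) (mem_consecutive hi))
  simp only at this
  unfold deltaP
  omega

/-- A set of indices without two indices at distance at least two is contained in a pair of
consecutive indices. -/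
lemma exists_consecutive_covering {n : ℕ} (hn : 2 ≤ n) (H : ℕ → Prop)
    (hH : ∀ i j, i + 1 < j → j < n → H i → H j → False) :
    ∃ i, i + 1 < n ∧ ∀ j < n, H j → j = i ∨ j = i + 1 := by
  classical
  by_cases hex : ∃ j, j < n ∧ H j
  · obtain ⟨h1, h2⟩ := Nat.find_spec hex
    have hmin : ∀ j < n, H j → Nat.find hex ≤ j := fun j h h' => Nat.find_min' hex ⟨h, h'⟩
    set a := Nat.find hex
    have hle : ∀ j < n, H j → j ≤ a + 1 := fun j h h' => by
      by_contra hlt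
      exact hH a j (by omega) h h2 h'
    by_cases ha : a + 1 < n
    · refine ⟨a, ha, fun j h h' => ?_⟩
      have := hmin j h h'
      have := hle j h h'
      omega
    · refine ⟨a - 1, by omega, fun j h h' => ?_⟩
      have := hmin j h h'
      omega
  · push Not at hex
    exact ⟨0, by omega, fun j h h' => absurd h' (hex j h)⟩

/-- Allows powers of two different factors to be split off a product simultaneously. -/
lemma replicate_add_replicate_le {α : Type*} [DecidableEq α] {m : Multiset α} {a b : α}
    (hab : a ≠ b) {i j : ℕ} (hi : i ≤ m.count a) (hj : j ≤ m.count b) :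
    Multiset.replicate i a + Multiset.replicate j b ≤ m := by
  rw [Multiset.le_iff_count]
  intro c
  rw [Multiset.count_add, Multiset.count_replicate, Multiset.count_replicate]
  by_cases h1 : a = c
  · subst h1
    simp [Ne.symm hab, hi]
  · by_cases h2 : b = c
    · subst h2
      simp [hab, hj]
    · simp [h1, h2]

end Lists

/-! ### The generators in `P` and the lines through consecutive ones -/

section Generators

variable {K : Type u} [Field K] {I : Ideal (Poly2 K)} {P : List (ℕ × ℕ)}

lemma fst_lt_of_snd_lt {p q : ℕ × ℕ} (hp : p ∈ mingens I) (hq : q ∈ mingens I)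
    (h : q.2 < p.2) : p.1 < q.1 := by
  by_contra hle
  have := eq_of_mem_mingens_of_le hp hq.1 ⟨not_lt.1 hle, h.le⟩
  rw [this] at h
  exact lt_irrefl _ h

lemma snd_lt_of_fst_lt {p q : ℕ × ℕ} (hp : p ∈ mingens I) (hq : q ∈ mingens I)
    (h : p.1 < q.1) : q.2 < p.2 := by
  by_contra hle
  have := eq_of_mem_mingens_of_le hq hp.1 ⟨h.le, not_lt.1 hle⟩
  rw [this] at h
  exact lt_irrefl _ h

lemma eq_of_fst_eq {p q : ℕ × ℕ} (hp : p ∈ mingens I) (hq : q ∈ mingens I)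
    (h : p.1 = q.1) : p = q := by
  rcases le_total p.2 q.2 with h' | h'
  · exact eq_of_mem_mingens_of_le hq hp.1 ⟨h.le, h'⟩
  · exact (eq_of_mem_mingens_of_le hp hq.1 ⟨h.ge, h'⟩).symm

lemma snd_getElem_lt (hP : DescY P) {i j : ℕ} (hij : i < j) (hj : j < P.length) :
    P[j].2 < P[i].2 :=
  List.pairwise_iff_getElem.1 hP i j _ hj hij

lemma fst_getElem_lt (hP : DescY P) (hweak : ∀ p ∈ P, p ∈ weaklyPersistentGens I) {i j : ℕ}
    (hij : i < j) (hj : j < P.length) : P[i].1 < P[j].1 :=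
  fst_lt_of_snd_lt (hweak _ (List.getElem_mem _)).1 (hweak _ (List.getElem_mem _)).1
    (snd_getElem_lt hP hij hj)

lemma exists_mon_mem (hI : IsMonomialIdeal I) (hprin : ¬ Submodule.IsPrincipal I) :
    ∃ p, mon K p ∈ I := by
  by_contra hne
  push Not at hne
  obtain ⟨E, rfl⟩ := hI
  refine hprin ?_
  have : E = ∅ := by
    rw [Set.eq_empty_iff_forall_notMem]
    exact fun p hp => hne p (Ideal.subset_span ⟨p, hp, rfl⟩)
  rw [this, Set.image_empty, Ideal.span_empty]
  exact bot_isPrincipal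

/-- The monomial of least `x`-degree, and among these of least `y`-degree, is persistent and so
belongs to `P`. -/
lemma exists_mem_le_fst (hI : ∃ p, mon K p ∈ I) (hper : ∀ p ∈ persistentGens I, p ∈ P) :
    ∃ e ∈ P, ∀ g, mon K g ∈ I → e.1 ≤ g.1 := by
  obtain ⟨e, he, hmin⟩ := exists_persistent_minimizing 1 0 0 1 (by norm_num) hI
  refine ⟨e, hper e he, fun g hg => ?_⟩
  have := hmin g hg
  omega

lemma exists_mem_le_snd (hI : ∃ p, mon K p ∈ I) (hper : ∀ p ∈ persistentGens I, p ∈ P) :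
    ∃ e ∈ P, ∀ g, mon K g ∈ I → e.2 ≤ g.2 := by
  obtain ⟨e, he, hmin⟩ := exists_persistent_minimizing 0 1 1 0 (by norm_num) hI
  refine ⟨e, hper e he, fun g hg => ?_⟩
  have := hmin g hg
  omega

/-- `P` contains monomials of least `x`-degree and of least `y`-degree; if these coincide, that
monomial divides everything in `I` and `I` is principal. -/
lemma two_le_length (hI : IsMonomialIdeal I) (hprin : ¬ Submodule.IsPrincipal I)
    (hper : ∀ p ∈ persistentGens I, p ∈ P) (hweak : ∀ p ∈ P, p ∈ weaklyPersistentGens I) :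
    2 ≤ P.length := by
  by_contra hlen
  obtain ⟨e, he, hmin⟩ := exists_mem_le_fst (exists_mon_mem hI hprin) hper
  obtain ⟨e', he', hmin'⟩ := exists_mem_le_snd (exists_mon_mem hI hprin) hper
  have hee : e = e' := by
    match P, hlen, he, he' with
    | [a], _, he, he' => rw [List.mem_singleton.1 he, List.mem_singleton.1 he']
    | [], _, he, _ => simp at he
    | a :: b :: t, hlen, _, _ => simp at hlen
  subst hee
  have hgens : mingens I = {e} := by
    ext p
    constructor
    · intro hp
      exact (eq_of_mem_mingens_of_le hp (hweak e he).1.1 ⟨hmin p hp.1, hmin' p hp.1⟩).symm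
    · rintro rfl
      exact (hweak _ he).1
  refine hprin ⟨⟨mon K e, ?_⟩⟩
  rw [eq_span_mingens hI, hgens, Set.image_singleton]

/-- The ideal lies on or above each of the lines through two consecutive elements of `P`. -/
lemma weight_le_of_consecutive (hP : DescY P) (hper : ∀ p ∈ persistentGens I, p ∈ P)
    (hweak : ∀ p ∈ P, p ∈ weaklyPersistentGens I) {i : ℕ} (hi : i + 1 < P.length)
    {p : ℕ × ℕ} (hp : mon K p ∈ I) :
    (P[i].2 - P[i + 1].2) * P[i].1 + (P[i + 1].1 - P[i].1) * P[i].2 ≤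
      (P[i].2 - P[i + 1].2) * p.1 + (P[i + 1].1 - P[i].1) * p.2 := by
  have hx := fst_getElem_lt hP hweak (Nat.lt_succ_self i) hi
  have hy := snd_getElem_lt hP (Nat.lt_succ_self i) hi
  have hg := hweak _ (List.getElem_mem (Nat.lt_of_succ_lt hi))
  have hh := hweak _ (List.getElem_mem hi)
  -- The weight is the one that is constant on the line through `P[i]` and `P[i + 1]`. Its
  -- persistent minimizer `f` lies in `P`, so it suffices to compare with `f`.
  obtain ⟨f, hf, hmin⟩ := exists_persistent_minimizing (P[i].2 - P[i + 1].2)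
    (P[i + 1].1 - P[i].1) 1 0 (by simp only [Nat.succ_eq_add_one] at hx; omega) ⟨p, hp⟩
  obtain ⟨j, hj, hjf⟩ := List.mem_iff_getElem.1 (hper f hf)
  have hfp : (P[i].2 - P[i + 1].2) * f.1 + (P[i + 1].1 - P[i].1) * f.2 ≤
      (P[i].2 - P[i + 1].2) * p.1 + (P[i + 1].1 - P[i].1) * p.2 := by
    rcases hmin p hp with h | h
    exacts [h.le, h.1.le]
  refine le_trans ?_ hfp
  -- If `f` lies to the left of `P[i]`, then `P[i]` is on or below the chord from `f` to `P[i + 1]`,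
  -- which puts `f` on or above the line; the right-hand side is symmetric.
  rcases lt_trichotomy j i with hji | rfl | hji
  · have h1 : f.1 < P[i].1 := hjf ▸ fst_getElem_lt hP hweak hji (Nat.lt_of_succ_lt hi)
    have hc := (le_combination_fst hg hf.1.1 hh.1.1 h1 hx).2
    simp only [Prod.snd_add, Prod.smul_snd, smul_eq_mul, Nat.succ_eq_add_one] at hc hx hy
    zify [hx.le, hy.le, h1.le, (h1.trans hx).le] at hc ⊢
    linarith
  · rw [hjf]
  · rcases Nat.eq_or_lt_of_le hji with rfl | hji
    · simp only [Nat.succ_eq_add_one] at hjf hx hy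
      rw [← hjf]
      zify [hx.le, hy.le]
      linarith
    · have h1 : P[i + 1].1 < f.1 := hjf ▸ fst_getElem_lt hP hweak hji hj
      have hc := (le_combination_fst hh hg.1.1 hf.1.1 hx h1).2
      simp only [Prod.snd_add, Prod.smul_snd, smul_eq_mul, Nat.succ_eq_add_one] at hc hx hy
      zify [hx.le, hy.le, h1.le, (hx.trans h1).le] at hc ⊢
      linarith

lemma exists_consecutive_around (hP : DescY P) (hI : ∃ p, mon K p ∈ I)
    (hper : ∀ p ∈ persistentGens I, p ∈ P) (hweak : ∀ p ∈ P, p ∈ weaklyPersistentGens I)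
    {f : ℕ × ℕ} (hf : f ∈ mingens I) (hfP : f ∉ P) :
    ∃ (i : ℕ) (hi : i + 1 < P.length), P[i].1 < f.1 ∧ f.1 < P[i + 1].1 := by
  classical
  have hne : ∀ p ∈ P, p.1 ≠ f.1 := fun p hp h => hfP (eq_of_fst_eq (hweak p hp).1 hf h ▸ hp)
  obtain ⟨e, he, hemin⟩ := exists_mem_le_fst hI hper
  obtain ⟨e', he', hemin'⟩ := exists_mem_le_snd hI hper
  have h1 : e.1 < f.1 := lt_of_le_of_ne (hemin f hf.1) (hne e he)
  have h2 : f.1 < e'.1 := by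
    refine lt_of_le_of_ne ?_ (hne e' he').symm
    by_contra hlt
    exact absurd (hemin' f hf.1)
      (not_le.2 (snd_lt_of_fst_lt (hweak e' he').1 hf (not_le.1 hlt)))
  obtain ⟨j, hj, rfl⟩ := List.mem_iff_getElem.1 he
  obtain ⟨j', hj', rfl⟩ := List.mem_iff_getElem.1 he'
  -- The first element of `P` to the right of `f` and its predecessor are the neighbours wanted.
  have hex : ∃ k, ∃ hk : k < P.length, f.1 < P[k].1 := ⟨j', hj', h2⟩
  obtain ⟨hk, hfk⟩ := Nat.find_spec hex
  have hmin := fun k => @Nat.find_min _ _ hex k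
  generalize Nat.find hex = k at hk hfk hmin
  have hjk : j < k := by
    by_contra hle
    rcases Nat.eq_or_lt_of_le (not_lt.1 hle) with rfl | hlt
    · omega
    · have := fst_getElem_lt hP hweak hlt hj
      omega
  obtain ⟨i, rfl⟩ := Nat.exists_eq_succ_of_ne_zero (Nat.ne_zero_of_lt hjk)
  refine ⟨i, hk, ?_, hfk⟩
  have := hmin i (Nat.lt_succ_self i)
  push Not at this
  exact lt_of_le_of_ne (this (by omega)) (hne _ (List.getElem_mem _))

/-- A generator outside `P` has a power, of controlled exponent, that is divisible by a product of
two consecutive elements of `P`. -/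
lemma exists_combination_le (hP : DescY P) (hI : ∃ p, mon K p ∈ I)
    (hper : ∀ p ∈ persistentGens I, p ∈ P) (hweak : ∀ p ∈ P, p ∈ weaklyPersistentGens I)
    {f : ℕ × ℕ} (hf : f ∈ mingens I) (hfP : f ∉ P) :
    ∃ g ∈ P, ∃ h ∈ P, ∃ a b : ℕ, 0 < a + b ∧ a + b ≤ deltaP P + 1 ∧
      a • g + b • h ≤ (a + b) • f := by
  obtain ⟨i, hi, h1, h2⟩ := exists_consecutive_around hP hI hper hweak hf hfP
  have hw := weight_le_of_consecutive hP hper hweak hi hf.1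
  have hd := min_distPair_le_deltaP hi
  have hg := List.getElem_mem (Nat.lt_of_succ_lt hi)
  have hh := List.getElem_mem hi
  have h3 := snd_lt_of_fst_lt (hweak _ hg).1 hf h1
  have h4 := snd_lt_of_fst_lt hf (hweak _ hh).1 h2
  refine ⟨P[i], hg, P[i + 1], hh, ?_⟩
  generalize P[i] = g at *
  generalize P[i + 1] = h at *
  unfold distPair at hd
  -- The exponents are distances along the variable that realizes the minimum in `δ_P`, so they add
  -- up to at most `δ_P + 1`. In that variable the degrees agree; in the other one the inequality
  -- says that `f` is on or above the line.
  rcases min_le_iff.1 hd with hd | hd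
  · refine ⟨h.1 - f.1, f.1 - g.1, by omega, by omega, ?_⟩
    constructor <;> simp only [Prod.fst_add, Prod.smul_fst, Prod.snd_add, Prod.smul_snd,
      smul_eq_mul]
    · zify [h1.le, h2.le]
      linarith
    · zify [h1.le, h2.le, h3.le, h4.le, (h1.trans h2).le, (h4.trans h3).le] at hw ⊢
      linarith
  · refine ⟨f.2 - h.2, g.2 - f.2, by omega, by omega, ?_⟩
    constructor <;> simp only [Prod.fst_add, Prod.smul_fst, Prod.snd_add, Prod.smul_snd,
      smul_eq_mul]
    · zify [h1.le, h2.le, h3.le, h4.le, (h1.trans h2).le, (h4.trans h3).le] at hw ⊢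
      linarith
    · zify [h3.le, h4.le]
      linarith

/-! ### The exchange argument and the decomposition of large powers -/

/-- Strict convexity of the square at the weighted mean `f` of `a` and `b`; this is why moving
factors inwards decreases the sum of squared degrees. -/
lemma convexity_lt {a f b : ℕ} (h1 : a < f) (h2 : f < b) :
    ((b - f) + (f - a)) * f ^ 2 < (b - f) * a ^ 2 + (f - a) * b ^ 2 := by
  obtain ⟨j, rfl⟩ := Nat.exists_eq_add_of_lt h1
  obtain ⟨i, rfl⟩ := Nat.exists_eq_add_of_lt h2
  have e1 : a + j + 1 + i + 1 - (a + j + 1) = i + 1 := by omega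
  have e2 : a + j + 1 - a = j + 1 := by omega
  rw [e1, e2]
  have : (i + 1) * a ^ 2 + (j + 1) * (a + j + 1 + i + 1) ^ 2 =
      (i + 1 + (j + 1)) * (a + j + 1) ^ 2 + (i + 1) * (j + 1) * ((i + 1) + (j + 1)) := by ring
  rw [this]
  exact Nat.lt_add_of_pos_right (by positivity)

/-- Every product of generators is divisible by a product of as many generators in which the
exponents of the generators outside `P` are bounded, and in which no two separated elements of `P`
both have a large exponent. -/
lemma exists_reduced_product (deg : ℕ × ℕ → ℕ) (hP : DescY P) (hI : ∃ p, mon K p ∈ I)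
    (hper : ∀ p ∈ persistentGens I, p ∈ P) (hweak : ∀ p ∈ P, p ∈ weaklyPersistentGens I)
    (hdeg : ∀ a ∈ P, ∀ f ∈ P, ∀ b ∈ P, deg a < deg f → deg f < deg b →
      ((deg b - deg f) + (deg f - deg a)) • f ≤ (deg b - deg f) • a + (deg f - deg a) • b)
    {n : ℕ} {p : ℕ × ℕ} (hp : ∃ m : Multiset (ℕ × ℕ), Multiset.card m = n ∧
      (∀ q ∈ m, q ∈ mingens I) ∧ m.sum ≤ p) :
    ∃ m : Multiset (ℕ × ℕ), (Multiset.card m = n ∧ (∀ q ∈ m, q ∈ mingens I) ∧ m.sum ≤ p) ∧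
      (∀ f ∈ mingens I, f ∉ P → m.count f ≤ deltaP P) ∧
      ∀ a ∈ P, ∀ f ∈ P, ∀ b ∈ P, deg a < deg f → deg f < deg b →
        ¬ (distIdeal deg I - 2 < m.count a ∧ distIdeal deg I - 2 < m.count b) := by
  -- The first exchange lowers the first component; the second one keeps the first component and
  -- lowers the second. A minimal multiset therefore admits neither.
  obtain ⟨m, ⟨hcard, hgen, hsum⟩, hmin⟩ := exists_minimalFor_of_wellFoundedLT _
    (fun m : Multiset (ℕ × ℕ) =>
      toLex (m.countP (· ∉ P), (m.map fun q => deg q ^ 2).sum)) hp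
  refine ⟨m, ⟨hcard, hgen, hsum⟩, ?_, ?_⟩
  · intro f hf hfP
    by_contra hlt
    obtain ⟨g, hg, h, hh, a, b, hpos, hab, hle⟩ :=
      exists_combination_le hP hI hper hweak hf hfP
    obtain ⟨r, rfl⟩ := le_iff_exists_add.1 (Multiset.le_count_iff_replicate_le.1
      (by omega : a + b ≤ m.count f))
    have hmem : ∀ q ∈ Multiset.replicate a g + Multiset.replicate b h + r, q ∈ mingens I := by
      intro q hq
      rcases Multiset.mem_add.1 hq with hq | hq
      · rcases Multiset.mem_add.1 hq with hq | hq
        · exact Multiset.eq_of_mem_replicate hq ▸ (hweak g hg).1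
        · exact Multiset.eq_of_mem_replicate hq ▸ (hweak h hh).1
      · exact hgen q (Multiset.mem_add.2 (Or.inr hq))
    have hlt : toLex ((Multiset.replicate a g + Multiset.replicate b h + r).countP (· ∉ P),
        ((Multiset.replicate a g + Multiset.replicate b h + r).map fun q => deg q ^ 2).sum) <
        toLex ((Multiset.replicate (a + b) f + r).countP (· ∉ P),
        ((Multiset.replicate (a + b) f + r).map fun q => deg q ^ 2).sum) := by
      rw [Prod.Lex.toLex_lt_toLex]
      left
      simp only [Multiset.countP_add, ← Multiset.coe_replicate, Multiset.coe_countP,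
        List.countP_replicate, hg, hh, hfP]
      simp [hpos]
    refine absurd (hmin ⟨?_, hmem, ?_⟩ hlt.le) (not_le.2 hlt)
    · simpa [add_assoc] using hcard
    · simp only [Multiset.sum_add, Multiset.sum_replicate] at hsum ⊢
      exact le_trans (add_le_add_left hle _) hsum
  · rintro a ha f hf b hb haf hfb ⟨hca, hcb⟩
    have hdist := sub_le_distIdeal deg (hweak b hb).1 (hweak a ha).1
    have hne : a ≠ b := by
      rintro rfl
      omega
    -- Both exponents are positive with sum at most the distance of `I`, so each is at most that
    -- distance minus one; this is the source of the `2` subtracted in `d_P`.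
    obtain ⟨r, rfl⟩ := le_iff_exists_add.1 (replicate_add_replicate_le hne
      (by omega : deg b - deg f ≤ m.count a) (by omega : deg f - deg a ≤ m.count b))
    set i := deg b - deg f with hi
    set j := deg f - deg a with hj
    have hmem : ∀ q ∈ Multiset.replicate (i + j) f + r, q ∈ mingens I := by
      intro q hq
      rcases Multiset.mem_add.1 hq with hq | hq
      · exact Multiset.eq_of_mem_replicate hq ▸ (hweak f hf).1
      · exact hgen q (Multiset.mem_add.2 (Or.inr hq))
    have hlt : toLex ((Multiset.replicate (i + j) f + r).countP (· ∉ P),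
        ((Multiset.replicate (i + j) f + r).map fun q => deg q ^ 2).sum) <
        toLex ((Multiset.replicate i a + Multiset.replicate j b + r).countP (· ∉ P),
        ((Multiset.replicate i a + Multiset.replicate j b + r).map fun q => deg q ^ 2).sum) := by
      rw [Prod.Lex.toLex_lt_toLex]
      right
      constructor
      · simp only [Multiset.countP_add, ← Multiset.coe_replicate, Multiset.coe_countP,
          List.countP_replicate, ha, hf, hb]
        simp
      · simp only [Multiset.map_add, Multiset.map_replicate, Multiset.sum_add,
          Multiset.sum_replicate, smul_eq_mul]
        exact Nat.add_lt_add_right (convexity_lt haf hfb) _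
    refine absurd (hmin ⟨?_, hmem, ?_⟩ hlt.le) (not_le.2 hlt)
    · simpa [add_assoc] using hcard
    · simp only [Multiset.sum_add, Multiset.sum_replicate] at hsum ⊢
      exact le_trans (add_le_add_left (hdeg a ha f hf b hb haf hfb) _) hsum

/-- Every product of `n` generators is divisible by a product of `n` generators of which all but
`bigD I P` belong to a pair of consecutive elements of `P`. -/
lemma exists_consecutive_count_le (hP : DescY P) (hI : IsMonomialIdeal I)
    (hprin : ¬ Submodule.IsPrincipal I)
    (hper : ∀ p ∈ persistentGens I, p ∈ P) (hweak : ∀ p ∈ P, p ∈ weaklyPersistentGens I)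
    {n : ℕ} {p : ℕ × ℕ} (hp : mon K p ∈ I ^ n) :
    ∃ (i : ℕ) (hi : i + 1 < P.length) (m : Multiset (ℕ × ℕ)), Multiset.card m = n ∧
      (∀ q ∈ m, q ∈ mingens I) ∧ m.sum ≤ p ∧
      n ≤ bigD I P + (m.count P[i] + m.count P[i + 1]) := by
  classical
  have hex := exists_mon_mem hI hprin
  have hlen := two_le_length hI hprin hper hweak
  rw [eq_span_mingens hI, mon_mem_span_pow_iff] at hp
  have key : ∃ m : Multiset (ℕ × ℕ),
      (Multiset.card m = n ∧ (∀ q ∈ m, q ∈ mingens I) ∧ m.sum ≤ p) ∧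
      (∀ f ∈ mingens I, f ∉ P → m.count f ≤ deltaP P) ∧
      ∀ (i j : ℕ) (hij : i + 1 < j) (hj : j < P.length),
        ¬ (dP I P < m.count P[i] ∧ dP I P < m.count P[j]) := by
    -- The exchange is measured in the variable that realizes the minimum in `d_P`. Separated
    -- indices `i + 1 < j` exist only if `|P| > 2`; for `|P| = 2` the condition is vacuous, which is
    -- why `d_P = 0` suffices there.
    rcases le_total (distIdeal Prod.fst I) (distIdeal Prod.snd I) with hle | hle
    · obtain ⟨m, h1, h2, h3⟩ := exists_reduced_product Prod.fst hP hex hper hweak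
        (fun a ha f hf b hb haf hfb => by
          have := le_combination_fst (hweak f hf) (hweak a ha).1.1 (hweak b hb).1.1 haf hfb
          rwa [(by omega : b.1 - f.1 + (f.1 - a.1) = b.1 - a.1)]) hp
      refine ⟨m, h1, h2, fun i j hij hj => ?_⟩
      rw [dP, if_pos (by omega), min_eq_left hle]
      exact h3 _ (List.getElem_mem _) P[i + 1] (List.getElem_mem _) _ (List.getElem_mem _)
        (fst_getElem_lt hP hweak (by omega) _) (fst_getElem_lt hP hweak hij _)
    · obtain ⟨m, h1, h2, h3⟩ := exists_reduced_product Prod.snd hP hex hper hweak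
        (fun a ha f hf b hb haf hfb => by
          have := le_combination_snd (hweak f hf) (hweak a ha).1.1 (hweak b hb).1.1 haf hfb
          rwa [(by omega : b.2 - f.2 + (f.2 - a.2) = b.2 - a.2)]) hp
      refine ⟨m, h1, h2, fun i j hij hj => ?_⟩
      rw [dP, if_pos (by omega), min_eq_right hle, and_comm]
      exact h3 _ (List.getElem_mem _) P[i + 1] (List.getElem_mem _) _ (List.getElem_mem _)
        (snd_getElem_lt hP hij _) (snd_getElem_lt hP (by omega) _)
  obtain ⟨m, ⟨hcard, hgen, hsum⟩, hout, hsep⟩ := key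
  -- The indices with exponent above `d_P` fit into one consecutive pair.
  obtain ⟨i, hi, hcover⟩ := exists_consecutive_covering hlen
    (fun j => ∃ hj : j < P.length, dP I P < m.count P[j])
    (fun i j hij hj ⟨_, h1⟩ ⟨_, h2⟩ => hsep i j hij hj ⟨h1, h2⟩)
  refine ⟨i, hi, m, hcard, hgen, hsum, ?_⟩
  have hsub : P.toFinset ⊆ (finite_mingens I).toFinset := by
    intro q hq
    rw [Set.Finite.mem_toFinset]
    exact (hweak q (List.mem_toFinset.1 hq)).1
  have hcardP : P.toFinset.card = P.length := by
    apply List.toFinset_card_of_nodup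
    exact hP.imp fun h => by
      rintro rfl
      exact lt_irrefl _ h
  -- Granting `d_P` to the two distinguished elements as well is wasteful, but makes the sum exactly
  -- `|P| * d_P` plus their two exponents.
  have hin : ∀ f ∈ P.toFinset, m.count f ≤ dP I P +
      ((if f = P[i] then m.count P[i] else 0) + if f = P[i + 1] then m.count P[i + 1] else 0) := by
    intro f hf
    obtain ⟨j, hj, rfl⟩ := List.mem_iff_getElem.1 (List.mem_toFinset.1 hf)
    by_cases hbig : dP I P < m.count P[j]
    · rcases hcover j hj ⟨hj, hbig⟩ with rfl | rfl
      · rw [if_pos rfl]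
        omega
      · rw [if_pos (rfl : P[i + 1] = P[i + 1])]
        omega
    · omega
  have hsum1 := Finset.sum_le_sum hin
  rw [Finset.sum_add_distrib, Finset.sum_add_distrib, Finset.sum_ite_eq', Finset.sum_ite_eq',
    if_pos (List.mem_toFinset.2 (List.getElem_mem _)),
    if_pos (List.mem_toFinset.2 (List.getElem_mem _)), Finset.sum_const, hcardP,
    smul_eq_mul] at hsum1
  have hsum2 : ∑ f ∈ (finite_mingens I).toFinset \ P.toFinset, m.count f ≤
      (numGens I - P.length) * deltaP P := by
    rw [numGens, Set.ncard_eq_toFinset_card _ (finite_mingens I), ← hcardP,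
      ← Finset.card_sdiff_of_subset hsub, ← smul_eq_mul]
    refine Finset.sum_le_card_nsmul _ _ _ fun f hf => ?_
    rw [Finset.mem_sdiff, Set.Finite.mem_toFinset, List.mem_toFinset] at hf
    exact hout f hf.1 hf.2
  have htot : ∑ f ∈ (finite_mingens I).toFinset, m.count f = n := by
    rw [← hcard]
    exact Multiset.sum_count_eq_card fun q hq => (Set.Finite.mem_toFinset _).2 (hgen q hq)
  rw [← Finset.sum_sdiff hsub] at htot
  unfold bigD
  omega

/-- For `s ≥ bigD I P` the power `I ^ (s + ℓ)` is the sum of the products of `I ^ s` with the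
`ℓ`-th powers of the ideals generated by two consecutive elements of `P`. -/
theorem mon_mem_pow_add_iff (hP : DescY P) (hI : IsMonomialIdeal I)
    (hprin : ¬ Submodule.IsPrincipal I)
    (hper : ∀ p ∈ persistentGens I, p ∈ P) (hweak : ∀ p ∈ P, p ∈ weaklyPersistentGens I)
    {s : ℕ} (hs : bigD I P ≤ s) (ℓ : ℕ) (p : ℕ × ℕ) :
    mon K p ∈ I ^ (s + ℓ) ↔ ∃ (i : ℕ) (hi : i + 1 < P.length), ∃ q ∈ mingens (I ^ s), ∃ j ≤ ℓ,
      j • P[i] + (ℓ - j) • P[i + 1] + q ≤ p := by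
  constructor
  · intro hp
    obtain ⟨i, hi, m, hcard, hgen, hsum, hcount⟩ :=
      exists_consecutive_count_le hP hI hprin hper hweak hp
    have hne : P[i] ≠ P[i + 1] := by
      intro h
      have := snd_getElem_lt hP (Nat.lt_succ_self i) hi
      rw [h] at this
      exact lt_irrefl _ this
    -- The two exponents add up to at least `s + ℓ - D_P ≥ ℓ`, so `ℓ` factors of the pair can be
    -- split off; the remaining `s` factors give an element of `I ^ s`.
    obtain ⟨j, hjl, hji, hjh⟩ : ∃ j ≤ ℓ, j ≤ m.count P[i] ∧ ℓ - j ≤ m.count P[i + 1] :=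
      ⟨min ℓ (m.count P[i]), min_le_left _ _, min_le_right _ _, by omega⟩
    obtain ⟨r, hmr⟩ := le_iff_exists_add.1 (replicate_add_replicate_le hne hji hjh)
    rw [hmr] at hcard hgen hsum
    have hr : Multiset.card r = s := by
      simp only [Multiset.card_add, Multiset.card_replicate] at hcard
      omega
    have hrI : mon K r.sum ∈ I ^ s :=
      hr ▸ mon_sum_mem_pow r fun q hq => (hgen q (Multiset.mem_add.2 (Or.inr hq))).1
    obtain ⟨q, hq, hqr⟩ := exists_mingens_le hrI
    refine ⟨i, hi, q, hq, j, hjl, le_trans ?_ hsum⟩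
    simp only [Multiset.sum_add, Multiset.sum_replicate]
    exact add_le_add_right hqr _
  · rintro ⟨i, hi, q, hq, j, hj, hle⟩
    refine mon_mem_of_le ?_ hle
    rw [mon_add, mon_add, mon_nsmul, mon_nsmul, add_comm s ℓ, pow_add,
      (by omega : ℓ = j + (ℓ - j)), pow_add, (by omega : j + (ℓ - j) - j = ℓ - j)]
    exact Ideal.mul_mem_mul (Ideal.mul_mem_mul
      (Ideal.pow_mem_pow (hweak _ (List.getElem_mem _)).1.1 _)
      (Ideal.pow_mem_pow (hweak _ (List.getElem_mem _)).1.1 _)) hq.1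

end Generators

/-! ### Frame rules and cost bounds for programs -/

section Frame

/-- The registers that a program may write. -/
def Prog.regs : Prog → List ℕ
  | .const r _ => [r]
  | .copy r _ => [r]
  | .add r _ _ => [r]
  | .push _ _ => []
  | .pop r _ => [r]
  | .len r _ => [r]
  | .seq p q => p.regs ++ q.regs
  | .ifLe _ _ p q => p.regs ++ q.regs
  | .loop _ p => p.regs

/-- The stacks that a program may write. -/
def Prog.stks : Prog → List ℕ
  | .const _ _ => []
  | .copy _ _ => []
  | .add _ _ _ => []
  | .push t _ => [t]
  | .pop _ t => [t]
  | .len _ _ => []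
  | .seq p q => p.stks ++ q.stks
  | .ifLe _ _ p q => p.stks ++ q.stks
  | .loop _ p => p.stks

/-- The largest number of steps of a loop-free program. -/
def Prog.cost : Prog → ℕ
  | .seq p q => p.cost + q.cost
  | .ifLe _ _ p q => max p.cost q.cost + 1
  | _ => 1

/-- A program has no loop. -/
def Prog.loopFree : Prog → Bool
  | .seq p q => p.loopFree && q.loopFree
  | .ifLe _ _ p q => p.loopFree && q.loopFree
  | .loop _ _ => false
  | _ => true

@[simp] lemma MState.tick_reg (σ : MState) : σ.tick.reg = σ.reg := rfl
@[simp] lemma MState.tick_stk (σ : MState) : σ.tick.stk = σ.stk := rfl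
@[simp] lemma MState.tick_steps (σ : MState) : σ.tick.steps = σ.steps + 1 := rfl
@[simp] lemma MState.tick_adds (σ : MState) : σ.tick.adds = σ.adds := rfl
@[simp] lemma MState.setReg_reg (σ : MState) (r n : ℕ) :
    (σ.setReg r n).reg = Function.update σ.reg r n := rfl
@[simp] lemma MState.setReg_stk (σ : MState) (r n : ℕ) : (σ.setReg r n).stk = σ.stk := rfl
@[simp] lemma MState.setReg_steps (σ : MState) (r n : ℕ) :
    (σ.setReg r n).steps = σ.steps := rfl
@[simp] lemma MState.setReg_adds (σ : MState) (r n : ℕ) : (σ.setReg r n).adds = σ.adds := rfl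
@[simp] lemma MState.setStk_reg (σ : MState) (t : ℕ) (l : List ℕ) :
    (σ.setStk t l).reg = σ.reg := rfl
@[simp] lemma MState.setStk_stk (σ : MState) (t : ℕ) (l : List ℕ) :
    (σ.setStk t l).stk = Function.update σ.stk t l := rfl
@[simp] lemma MState.setStk_steps (σ : MState) (t : ℕ) (l : List ℕ) :
    (σ.setStk t l).steps = σ.steps := rfl
@[simp] lemma MState.setStk_adds (σ : MState) (t : ℕ) (l : List ℕ) :
    (σ.setStk t l).adds = σ.adds := rfl
@[simp] lemma MState.countAdd_reg (σ : MState) : σ.countAdd.reg = σ.reg := rfl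
@[simp] lemma MState.countAdd_stk (σ : MState) : σ.countAdd.stk = σ.stk := rfl
@[simp] lemma MState.countAdd_steps (σ : MState) : σ.countAdd.steps = σ.steps := rfl
@[simp] lemma MState.countAdd_adds (σ : MState) : σ.countAdd.adds = σ.adds + 1 := rfl

/-- A loop preserves an invariant indexed by the number of rounds. -/
lemma run_loop_induct {a : ℕ} {p : Prog} {σ : MState} (Inv : ℕ → MState → Prop)
    (h0 : Inv 0 σ.tick)
    (hs : ∀ n < σ.reg a, ∀ τ, Inv n τ → Inv (n + 1) (p.run τ.tick)) :
    Inv (σ.reg a) ((Prog.loop a p).run σ) := by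
  have : ∀ n ≤ σ.reg a, Inv n ((fun τ : MState => p.run τ.tick)^[n] σ.tick) := by
    intro n
    induction n with
    | zero => exact fun _ => h0
    | succ n ih =>
      intro hn
      rw [Function.iterate_succ_apply']
      exact hs n (by omega) _ (ih (by omega))
  exact this _ le_rfl

/-- Write sets are computable lists, so for concrete programs preservation of a register is settled
by `decide`, even through nested loops. -/
lemma run_reg_of_notMem {Q : Prog} {r : ℕ} (h : r ∉ Q.regs) (σ : MState) :
    (Q.run σ).reg r = σ.reg r := by
  induction Q generalizing σ with
  | seq p q hp hq =>
    simp only [Prog.regs, List.mem_append, not_or] at h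
    rw [Prog.run, hq h.2, hp h.1]
  | ifLe a b p q hp hq =>
    simp only [Prog.regs, List.mem_append, not_or] at h
    rw [Prog.run]
    split_ifs
    · rw [hp h.1, MState.tick_reg]
    · rw [hq h.2, MState.tick_reg]
  | loop a p hp =>
    exact run_loop_induct (fun _ τ => τ.reg r = σ.reg r) rfl
      fun n _ τ hτ => by rw [hp h, MState.tick_reg, hτ]
  | _ =>
    simp only [Prog.regs, List.mem_singleton, List.not_mem_nil, not_false_eq_true] at h
    simp [Prog.run, h]

lemma run_stk_of_notMem {Q : Prog} {t : ℕ} (h : t ∉ Q.stks) (σ : MState) :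
    (Q.run σ).stk t = σ.stk t := by
  induction Q generalizing σ with
  | seq p q hp hq =>
    simp only [Prog.stks, List.mem_append, not_or] at h
    rw [Prog.run, hq h.2, hp h.1]
  | ifLe a b p q hp hq =>
    simp only [Prog.stks, List.mem_append, not_or] at h
    rw [Prog.run]
    split_ifs
    · rw [hp h.1, MState.tick_stk]
    · rw [hq h.2, MState.tick_stk]
  | loop a p hp =>
    exact run_loop_induct (fun _ τ => τ.stk t = σ.stk t) rfl
      fun n _ τ hτ => by rw [hp h, MState.tick_stk, hτ]
  | _ =>
    simp only [Prog.stks, List.mem_singleton, List.not_mem_nil, not_false_eq_true] at h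
    simp [Prog.run, h]

/-- Every addition is a step. -/
lemma run_adds_le (Q : Prog) (σ : MState) :
    (Q.run σ).adds + σ.steps ≤ (Q.run σ).steps + σ.adds := by
  induction Q generalizing σ with
  | seq p q hp hq =>
    have h1 := hp σ
    have h2 := hq (p.run σ)
    rw [Prog.run]
    omega
  | ifLe a b p q hp hq =>
    have h1 := hp σ.tick
    have h2 := hq σ.tick
    rw [Prog.run]
    simp only [MState.tick_steps, MState.tick_adds] at h1 h2
    split_ifs <;> omega
  | loop a p hp =>
    refine run_loop_induct (fun _ τ => τ.adds + σ.steps ≤ τ.steps + σ.adds) ?_ ?_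
    · simp only [MState.tick_steps, MState.tick_adds]
      omega
    · intro n _ τ hτ
      have h1 := hp τ.tick
      simp only [MState.tick_steps, MState.tick_adds] at h1
      omega
  | _ =>
    simp only [Prog.run, MState.tick_steps, MState.tick_adds, MState.setReg_steps,
      MState.setReg_adds, MState.setStk_steps, MState.setStk_adds, MState.countAdd_steps,
      MState.countAdd_adds]
    omega

lemma run_steps_le_cost {Q : Prog} (h : Q.loopFree = true) (σ : MState) :
    (Q.run σ).steps ≤ σ.steps + Q.cost := by
  induction Q generalizing σ with
  | seq p q hp hq =>
    simp only [Prog.loopFree, Bool.and_eq_true] at h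
    have h1 := hp h.1 σ
    have h2 := hq h.2 (p.run σ)
    rw [Prog.run, Prog.cost]
    omega
  | ifLe a b p q hp hq =>
    simp only [Prog.loopFree, Bool.and_eq_true] at h
    have h1 := hp h.1 σ.tick
    have h2 := hq h.2 σ.tick
    simp only [MState.tick_steps] at h1 h2
    rw [Prog.run, Prog.cost]
    split_ifs <;> omega
  | loop a p hp => simp [Prog.loopFree] at h
  | _ => simp [Prog.run, Prog.cost]

/-- Covers the innermost loops; nested loops are bounded together with their invariants. -/
lemma run_loop_steps_le {p : Prog} (h : p.loopFree = true) (a : ℕ) (σ : MState) :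
    ((Prog.loop a p).run σ).steps ≤ σ.steps + 1 + σ.reg a * (p.cost + 1) := by
  refine run_loop_induct (fun n τ => τ.steps ≤ σ.steps + 1 + n * (p.cost + 1)) (by simp) ?_
  intro n _ τ hτ
  have h1 := run_steps_le_cost h τ.tick
  rw [MState.tick_steps] at h1
  rw [Nat.succ_mul]
  omega

end Frame

/-! ### Lists of monomials on a stack -/

section Encoding

@[simp] lemma encodeMons_nil : encodeMons [] = [] := rfl

@[simp] lemma encodeMons_cons (p : ℕ × ℕ) (L : List (ℕ × ℕ)) :
    encodeMons (p :: L) = p.1 :: p.2 :: encodeMons L := rfl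

@[simp] lemma encodeMons_append (L M : List (ℕ × ℕ)) :
    encodeMons (L ++ M) = encodeMons L ++ encodeMons M := List.flatMap_append

@[simp] lemma length_encodeMons (L : List (ℕ × ℕ)) : (encodeMons L).length = 2 * L.length := by
  induction L with
  | nil => rfl
  | cons p L ih => simp [ih]; ring

end Encoding

/-! ### Subprograms: producing, merging and filtering segments -/

section Programs

/-- Move stack `a` onto stack `b`, entry by entry. -/
def moveProg (a b : ℕ) : Prog :=
  .seq (.len 9 a) (.loop 9 (.seq (.pop 10 a) (.push b 10)))

/-- The reversal is wanted: output accumulates in reverse, and one move restores both the order of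
the monomials and the order of the exponents in each pair. -/
lemma moveProg_stk {a b : ℕ} (hab : a ≠ b) (σ : MState) :
    ((moveProg a b).run σ).stk a = [] ∧
      ((moveProg a b).run σ).stk b = (σ.stk a).reverse ++ σ.stk b := by
  have key := run_loop_induct (a := 9) (p := .seq (.pop 10 a) (.push b 10))
    (σ := (Prog.len 9 a).run σ)
    (fun n τ => τ.stk a = (σ.stk a).drop n ∧
      τ.stk b = ((σ.stk a).take n).reverse ++ σ.stk b) (by simp [Prog.run]) ?_
  · have e : ((Prog.len 9 a).run σ).reg 9 = (σ.stk a).length := by simp [Prog.run]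
    rw [e, List.drop_length, List.take_length] at key
    exact key
  · intro n hn τ ⟨h1, h2⟩
    have hn : n < (σ.stk a).length := by simpa [Prog.run] using hn
    rw [List.drop_eq_getElem_cons hn] at h1
    have e : ((σ.stk a).take (n + 1)).reverse = (σ.stk a)[n] :: ((σ.stk a).take n).reverse := by
      rw [List.take_add_one, List.getElem?_eq_getElem hn]
      simp
    rw [e]
    generalize (σ.stk a).drop (n + 1) = l at *
    generalize (σ.stk a)[n] = x at *
    constructor
    · simp [Prog.run, h1, hab]
    · simp [Prog.run, h1, h2, hab.symm]

lemma moveProg_steps (a b : ℕ) (σ : MState) :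
    ((moveProg a b).run σ).steps ≤ σ.steps + 2 + 3 * (σ.stk a).length := by
  have := run_loop_steps_le (p := .seq (.pop 10 a) (.push b 10)) rfl 9 ((Prog.len 9 a).run σ)
  simp only [Prog.run, Prog.cost, MState.tick_reg, MState.setReg_reg, Function.update_self,
    MState.tick_steps, MState.setReg_steps] at this
  simp only [moveProg, Prog.run, MState.tick_reg, MState.setReg_reg, Function.update_self]
  omega

/-- The products of `q` with the monomials of degree `m - 1` in `g` and `h`. -/
def segList (g h q : ℕ × ℕ) (m : ℕ) : List (ℕ × ℕ) :=
  (List.range m).reverse.map fun j => j • g + (m - 1 - j) • h + q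

/-- Push the first multiples of the registers `3, 4`, shifted by the registers `5, 6`, onto
stack `4`. -/
def multiplesProg : Prog :=
  .seq (.copy 7 5) (.seq (.copy 8 6) (.loop 11
    (.seq (.push 4 8) (.seq (.push 4 7) (.seq (.add 7 7 3) (.add 8 8 4))))))

lemma multiplesProg_stk (σ : MState) (h q : ℕ × ℕ) (h4 : σ.stk 4 = [])
    (r3 : σ.reg 3 = h.1) (r4 : σ.reg 4 = h.2) (r5 : σ.reg 5 = q.1) (r6 : σ.reg 6 = q.2) :
    (multiplesProg.run σ).stk 4 =
      encodeMons ((List.range (σ.reg 11)).reverse.map fun j => j • h + q) := by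
  have key := run_loop_induct (a := 11)
    (p := .seq (.push 4 8) (.seq (.push 4 7) (.seq (.add 7 7 3) (.add 8 8 4))))
    (σ := (Prog.seq (.copy 7 5) (.copy 8 6)).run σ)
    (fun n τ => τ.stk 4 = encodeMons ((List.range n).reverse.map fun j => j • h + q) ∧
      τ.reg 7 = n * h.1 + q.1 ∧ τ.reg 8 = n * h.2 + q.2 ∧ τ.reg 3 = h.1 ∧ τ.reg 4 = h.2)
    (by simp [Prog.run, h4, r3, r4, r5, r6]) ?_
  · have e : ((Prog.seq (.copy 7 5) (.copy 8 6)).run σ).reg 11 = σ.reg 11 :=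
      run_reg_of_notMem (by decide) σ
    rw [e] at key
    exact key.1
  · rintro n - τ ⟨h1, h2, h3, h5, h6⟩
    simp [Prog.run, h1, h2, h3, h5, h6, List.range_succ]
    constructor <;> ring

/-- Add the multiples of the registers `1, 2` to the monomials on stack `4` and push the results
onto stack `3`. -/
def combineProg : Prog :=
  .seq (.const 7 0) (.seq (.const 8 0) (.loop 11
    (.seq (.pop 9 4) (.seq (.pop 10 4) (.seq (.add 9 9 7) (.seq (.add 10 10 8)
      (.seq (.push 3 10) (.seq (.push 3 9) (.seq (.add 7 7 1) (.add 8 8 2))))))))))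

/-- Popping yields the multiples of `h` from the largest down while the multiples of `g` grow, so
the exponents in each round add up to `m - 1`. Every monomial of a segment thus costs a constant
number of additions. -/
lemma combineProg_stk (σ : MState) (g h q : ℕ × ℕ) (m : ℕ) (h3 : σ.stk 3 = [])
    (h4 : σ.stk 4 = encodeMons ((List.range m).reverse.map fun j => j • h + q))
    (r1 : σ.reg 1 = g.1) (r2 : σ.reg 2 = g.2) (r11 : σ.reg 11 = m) :
    (combineProg.run σ).stk 4 = [] ∧ (combineProg.run σ).stk 3 = encodeMons (segList g h q m) := by
  have e : ((Prog.seq (.const 7 0) (.const 8 0)).run σ).reg 11 = m := by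
    rw [run_reg_of_notMem (by decide), r11]
  have key := run_loop_induct (a := 11)
    (p := .seq (.pop 9 4) (.seq (.pop 10 4) (.seq (.add 9 9 7) (.seq (.add 10 10 8)
      (.seq (.push 3 10) (.seq (.push 3 9) (.seq (.add 7 7 1) (.add 8 8 2))))))))
    (σ := (Prog.seq (.const 7 0) (.const 8 0)).run σ)
    (fun n τ => τ.stk 4 = encodeMons ((List.range (m - n)).reverse.map fun j => j • h + q) ∧
      τ.stk 3 = encodeMons ((List.range n).reverse.map fun j => j • g + (m - 1 - j) • h + q) ∧
      τ.reg 7 = n * g.1 ∧ τ.reg 8 = n * g.2 ∧ τ.reg 1 = g.1 ∧ τ.reg 2 = g.2)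
    (by simp [Prog.run, h3, h4, r1, r2]) ?_
  · rw [e] at key
    rw [Nat.sub_self] at key
    exact ⟨key.1, key.2.1⟩
  · rintro n hn τ ⟨h1, h2, h5, h6, h7, h8⟩
    rw [e] at hn
    -- The same `k` is the number of multiples left on the stack after the round and the exponent of
    -- `h` in it.
    obtain ⟨k, hk⟩ : ∃ k, m - n = k + 1 := ⟨m - n - 1, by omega⟩
    have hk1 : m - (n + 1) = k := by omega
    have hk2 : m - 1 - n = k := by omega
    rw [hk, List.range_succ, List.reverse_append, List.reverse_singleton, List.singleton_append,
      List.map_cons, encodeMons_cons] at h1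
    rw [hk1]
    simp [Prog.run, h1, h2, h5, h6, h7, h8, List.range_succ, hk2]
    refine ⟨⟨?_, ?_⟩, ?_, ?_⟩ <;> ring

/-- The lexicographic comparison of monomials. -/
def lexLe (a b : ℕ × ℕ) : Bool := decide (a.1 < b.1 ∨ a.1 = b.1 ∧ a.2 ≤ b.2)

/-- One round of merging the stacks `2` and `3` into stack `5`. -/
def mergeStep : Prog :=
  .seq (.len 16 2) (.seq (.len 17 3) (.seq (.const 18 1)
    (.ifLe 18 16
      (.ifLe 18 17
        (.seq (.pop 19 2) (.seq (.pop 20 2) (.seq (.pop 21 3) (.seq (.pop 22 3)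
          (.ifLe 19 21
            (.ifLe 21 19
              (.ifLe 20 22
                (.seq (.push 5 19) (.seq (.push 5 20) (.seq (.push 3 22) (.push 3 21))))
                (.seq (.push 5 21) (.seq (.push 5 22) (.seq (.push 2 20) (.push 2 19)))))
              (.seq (.push 5 19) (.seq (.push 5 20) (.seq (.push 3 22) (.push 3 21)))))
            (.seq (.push 5 21) (.seq (.push 5 22) (.seq (.push 2 20) (.push 2 19)))))))))
        (.seq (.pop 19 2) (.seq (.pop 20 2) (.seq (.push 5 19) (.push 5 20)))))
      (.ifLe 18 17
        (.seq (.pop 21 3) (.seq (.pop 22 3) (.seq (.push 5 21) (.push 5 22))))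
        (.const 18 1)))))

/-- Surplus rounds, on two empty stacks, change nothing on these stacks, so an upper bound for the
number of rounds suffices. `L` is the output so far, stored in reverse. -/
lemma mergeStep_iterate (n : ℕ) (A B L : List (ℕ × ℕ)) (τ : MState)
    (hn : A.length + B.length ≤ n) (h2 : τ.stk 2 = encodeMons A) (h3 : τ.stk 3 = encodeMons B)
    (h5 : τ.stk 5 = (encodeMons L).reverse) :
    let τ' := (fun τ : MState => mergeStep.run τ.tick)^[n] τ
    τ'.stk 2 = [] ∧ τ'.stk 3 = [] ∧
      τ'.stk 5 = (encodeMons (L ++ A.merge B lexLe)).reverse := by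
  induction n generalizing A B L τ with
  | zero =>
    obtain ⟨rfl, rfl⟩ : A = [] ∧ B = [] := by
      constructor <;> exact List.eq_nil_of_length_eq_zero (by omega)
    simpa using ⟨h2, h3, h5⟩
  | succ n ih =>
    simp only [Function.iterate_succ_apply]
    match A, B with
    | [], [] =>
      exact ih [] [] L (mergeStep.run τ.tick) (by simp) (by simp [mergeStep, Prog.run, h2, h3])
        (by simp [mergeStep, Prog.run, h2, h3])
        (by simp [mergeStep, Prog.run, h2, h3, h5])
    | a :: A, [] =>
      have := ih A [] (L ++ [a]) (mergeStep.run τ.tick) (by simp at hn ⊢; omega)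
        (by simp [mergeStep, Prog.run, h2, h3])
        (by simp [mergeStep, Prog.run, h2, h3])
        (by simp [mergeStep, Prog.run, h2, h3, h5])
      simpa using this
    | [], b :: B =>
      have := ih [] B (L ++ [b]) (mergeStep.run τ.tick) (by simp at hn ⊢; omega)
        (by simp [mergeStep, Prog.run, h2, h3])
        (by simp [mergeStep, Prog.run, h2, h3])
        (by simp [mergeStep, Prog.run, h2, h3, h5])
      simpa using this
    | a :: A, b :: B =>
      by_cases hab : lexLe a b = true
      · have hab' := of_decide_eq_true hab
        have hle : a.1 ≤ b.1 := by omega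
        have := ih A (b :: B) (L ++ [a]) (mergeStep.run τ.tick) (by simp at hn ⊢; omega)
          (by
            by_cases h1 : b.1 ≤ a.1
            · have h6 : a.2 ≤ b.2 := by omega
              simp [mergeStep, Prog.run, h2, h3, hle, h1, h6]
            · simp [mergeStep, Prog.run, h2, h3, hle, h1])
          (by
            by_cases h1 : b.1 ≤ a.1
            · have h6 : a.2 ≤ b.2 := by omega
              simp [mergeStep, Prog.run, h2, h3, hle, h1, h6]
            · simp [mergeStep, Prog.run, h2, h3, hle, h1])
          (by
            by_cases h1 : b.1 ≤ a.1
            · have h6 : a.2 ≤ b.2 := by omega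
              simp [mergeStep, Prog.run, h2, h3, h5, hle, h1, h6]
            · simp [mergeStep, Prog.run, h2, h3, h5, hle, h1])
        rw [List.append_assoc, List.singleton_append] at this
        rw [List.cons_merge_cons_pos _ _ _ hab]
        exact this
      · have hab' := mt decide_eq_true hab
        have := ih (a :: A) B (L ++ [b]) (mergeStep.run τ.tick) (by simp at hn ⊢; omega)
          (by
            by_cases hle : a.1 ≤ b.1
            · have h1 : b.1 ≤ a.1 := by omega
              have h6 : ¬ a.2 ≤ b.2 := by omega
              simp [mergeStep, Prog.run, h2, h3, hle, h1, h6]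
            · simp [mergeStep, Prog.run, h2, h3, hle])
          (by
            by_cases hle : a.1 ≤ b.1
            · have h1 : b.1 ≤ a.1 := by omega
              have h6 : ¬ a.2 ≤ b.2 := by omega
              simp [mergeStep, Prog.run, h2, h3, hle, h1, h6]
            · simp [mergeStep, Prog.run, h2, h3, hle])
          (by
            by_cases hle : a.1 ≤ b.1
            · have h1 : b.1 ≤ a.1 := by omega
              have h6 : ¬ a.2 ≤ b.2 := by omega
              simp [mergeStep, Prog.run, h2, h3, h5, hle, h1, h6]
            · simp [mergeStep, Prog.run, h2, h3, h5, hle])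
        rw [List.append_assoc, List.singleton_append] at this
        rw [List.cons_merge_cons_neg _ _ _ hab]
        exact this

/-- Merge stack `3` into stack `2`, using stack `5`. -/
def mergeProg : Prog :=
  .seq (.seq (.len 9 2) (.seq (.len 10 3) (.add 9 9 10)))
    (.seq (.loop 9 mergeStep) (moveProg 5 2))

lemma mergeProg_run (σ : MState) (A B : List (ℕ × ℕ)) (h2 : σ.stk 2 = encodeMons A)
    (h3 : σ.stk 3 = encodeMons B) (h5 : σ.stk 5 = []) :
    (mergeProg.run σ).stk 2 = encodeMons (A.merge B lexLe) ∧ (mergeProg.run σ).stk 3 = [] ∧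
      (mergeProg.run σ).stk 5 = [] ∧
      (mergeProg.run σ).steps ≤ σ.steps + 6 + 50 * (A.length + B.length) := by
  set τ := (Prog.seq (.len 9 2) (.seq (.len 10 3) (.add 9 9 10))).run σ with hτ
  -- Stack heights count exponents, two per monomial, so the loop runs twice as often as needed.
  have e9 : τ.reg 9 = 2 * A.length + 2 * B.length := by simp [hτ, Prog.run, h2, h3]
  have t2 : τ.tick.stk 2 = encodeMons A := by simp [hτ, Prog.run, h2]
  have t3 : τ.tick.stk 3 = encodeMons B := by simp [hτ, Prog.run, h3]
  have t5 : τ.tick.stk 5 = (encodeMons []).reverse := by simp [hτ, Prog.run, h5]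
  have ts : τ.steps = σ.steps + 3 := by simp [hτ, Prog.run]
  obtain ⟨i2, i3, i5⟩ := mergeStep_iterate (τ.reg 9) A B [] τ.tick (by omega) t2 t3 t5
  have hs := run_loop_steps_le (p := mergeStep) rfl 9 τ
  set υ := (Prog.loop 9 mergeStep).run τ with hυ
  replace i2 : υ.stk 2 = [] := i2
  replace i3 : υ.stk 3 = [] := i3
  replace i5 : υ.stk 5 = (encodeMons (A.merge B lexLe)).reverse := i5
  obtain ⟨j5, j2⟩ := moveProg_stk (a := 5) (b := 2) (by decide) υ
  have hs' := moveProg_steps 5 2 υ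
  rw [i2, i5, List.reverse_reverse, List.append_nil] at j2
  have hrun : mergeProg.run σ = (moveProg 5 2).run υ := rfl
  have hc : mergeStep.cost = 16 := rfl
  rw [i5, List.length_reverse, length_encodeMons, List.length_merge] at hs'
  rw [e9, hc] at hs
  rw [hrun]
  refine ⟨j2, ?_, j5, by omega⟩
  rw [run_stk_of_notMem (by decide), i3]

/-- Merge the products of the registers `5, 6` with the products of the registers `1, 2` and the
registers `3, 4` into stack `2`. -/
def addSegProg : Prog := .seq multiplesProg (.seq combineProg mergeProg)

lemma addSegProg_run (σ : MState) (g h q : ℕ × ℕ) (m : ℕ) (R : List (ℕ × ℕ))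
    (h2 : σ.stk 2 = encodeMons R) (h3 : σ.stk 3 = []) (h4 : σ.stk 4 = []) (h5 : σ.stk 5 = [])
    (r1 : σ.reg 1 = g.1) (r2 : σ.reg 2 = g.2) (r3 : σ.reg 3 = h.1) (r4 : σ.reg 4 = h.2)
    (r5 : σ.reg 5 = q.1) (r6 : σ.reg 6 = q.2) (r11 : σ.reg 11 = m) :
    (addSegProg.run σ).stk 2 = encodeMons (R.merge (segList g h q m) lexLe) ∧
      (addSegProg.run σ).stk 3 = [] ∧ (addSegProg.run σ).stk 4 = [] ∧
      (addSegProg.run σ).stk 5 = [] ∧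
      (addSegProg.run σ).steps ≤ σ.steps + 12 + 64 * (R.length + m) := by
  have a4 := multiplesProg_stk σ h q h4 r3 r4 r5 r6
  have as : (multiplesProg.run σ).steps ≤ σ.steps + 3 + 5 * m := by
    have := run_loop_steps_le
      (p := .seq (.push 4 8) (.seq (.push 4 7) (.seq (.add 7 7 3) (.add 8 8 4)))) rfl 11
      ((Prog.seq (.copy 7 5) (.copy 8 6)).run σ)
    rw [run_reg_of_notMem (by decide), r11] at this
    have hc : (Prog.seq (.push 4 8) (.seq (.push 4 7) (.seq (.add 7 7 3) (.add 8 8 4)))).cost = 4 :=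
      rfl
    have hp : ((Prog.seq (.copy 7 5) (.copy 8 6)).run σ).steps = σ.steps + 2 := rfl
    rw [hc, hp] at this
    have hrun : multiplesProg.run σ = (Prog.loop 11
      (.seq (.push 4 8) (.seq (.push 4 7) (.seq (.add 7 7 3) (.add 8 8 4))))).run
      ((Prog.seq (.copy 7 5) (.copy 8 6)).run σ) := rfl
    rw [hrun]
    omega
  have areg : ∀ r, r ∉ multiplesProg.regs → (multiplesProg.run σ).reg r = σ.reg r :=
    fun r hr => run_reg_of_notMem hr σ
  have astk : ∀ t, t ∉ multiplesProg.stks → (multiplesProg.run σ).stk t = σ.stk t :=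
    fun t ht => run_stk_of_notMem ht σ
  have hrun : addSegProg.run σ = mergeProg.run (combineProg.run (multiplesProg.run σ)) := rfl
  rw [hrun]
  generalize multiplesProg.run σ = τ at *
  rw [r11] at a4
  obtain ⟨b4, b3⟩ := combineProg_stk τ g h q m (by rw [astk 3 (by decide), h3]) a4
    (by rw [areg 1 (by decide), r1]) (by rw [areg 2 (by decide), r2])
    (by rw [areg 11 (by decide), r11])
  have bs : (combineProg.run τ).steps ≤ τ.steps + 3 + 9 * m := by
    have := run_loop_steps_le (p := .seq (.pop 9 4) (.seq (.pop 10 4) (.seq (.add 9 9 7)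
      (.seq (.add 10 10 8) (.seq (.push 3 10) (.seq (.push 3 9) (.seq (.add 7 7 1)
      (.add 8 8 2)))))))) rfl 11 ((Prog.seq (.const 7 0) (.const 8 0)).run τ)
    rw [run_reg_of_notMem (by decide), areg 11 (by decide), r11] at this
    have hc : (Prog.seq (.pop 9 4) (.seq (.pop 10 4) (.seq (.add 9 9 7)
      (.seq (.add 10 10 8) (.seq (.push 3 10) (.seq (.push 3 9) (.seq (.add 7 7 1)
      (.add 8 8 2)))))))).cost = 8 := rfl
    have hp : ((Prog.seq (.const 7 0) (.const 8 0)).run τ).steps = τ.steps + 2 := rfl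
    rw [hc, hp] at this
    have hrun : combineProg.run τ = (Prog.loop 11 (.seq (.pop 9 4) (.seq (.pop 10 4)
      (.seq (.add 9 9 7) (.seq (.add 10 10 8) (.seq (.push 3 10) (.seq (.push 3 9)
      (.seq (.add 7 7 1) (.add 8 8 2))))))))).run
      ((Prog.seq (.const 7 0) (.const 8 0)).run τ) := rfl
    rw [hrun]
    omega
  have b2 : (combineProg.run τ).stk 2 = encodeMons R := by
    rw [run_stk_of_notMem (by decide), astk 2 (by decide), h2]
  have b5 : (combineProg.run τ).stk 5 = [] := by
    rw [run_stk_of_notMem (by decide), astk 5 (by decide), h5]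
  generalize combineProg.run τ = υ at *
  obtain ⟨c2, c3, c5, cs⟩ := mergeProg_run υ R _ b2 b3 b5
  refine ⟨c2, c3, ?_, c5, ?_⟩
  · rw [run_stk_of_notMem (by decide), b4]
  · have : (segList g h q m).length = m := by simp [segList]
    omega

/-- Merge into `R` the segments between `g` and `h` shifted by the elements of `G`. -/
def mergeSegs (g h : ℕ × ℕ) (m : ℕ) (G R : List (ℕ × ℕ)) : List (ℕ × ℕ) :=
  G.foldl (fun R q => R.merge (segList g h q m) lexLe) R

lemma length_mergeSegs (g h : ℕ × ℕ) (m : ℕ) (G R : List (ℕ × ℕ)) :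
    (mergeSegs g h m G R).length = R.length + G.length * m := by
  induction G generalizing R with
  | nil => simp [mergeSegs]
  | cons q G ih =>
    have := ih (R.merge (segList g h q m) lexLe)
    rw [List.length_merge] at this
    have hl : (segList g h q m).length = m := by simp [segList]
    rw [hl] at this
    rw [List.length_cons, Nat.succ_mul]
    exact this.trans (by ring)

/-- Process one element of stack `0` and put it onto stack `6`. -/
def gensStep : Prog :=
  .seq (.len 16 0) (.seq (.const 18 1) (.ifLe 18 16
    (.seq (.seq (.pop 5 0) (.seq (.pop 6 0) (.seq (.push 6 5) (.push 6 6)))) addSegProg)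
    (.const 18 1)))

/-- `R.length + A.length * m` is preserved when an element is processed. Its bound `B` therefore
limits every intermediate list and gives one cost for all rounds. -/
lemma gensStep_iterate (n : ℕ) (g h : ℕ × ℕ) (m B : ℕ) (A L R : List (ℕ × ℕ)) (τ : MState)
    (hn : A.length ≤ n) (hB : R.length + A.length * m ≤ B)
    (h0 : τ.stk 0 = encodeMons A) (h6 : τ.stk 6 = (encodeMons L).reverse)
    (h2 : τ.stk 2 = encodeMons R) (h3 : τ.stk 3 = []) (h4 : τ.stk 4 = []) (h5 : τ.stk 5 = [])
    (r1 : τ.reg 1 = g.1) (r2 : τ.reg 2 = g.2) (r3 : τ.reg 3 = h.1) (r4 : τ.reg 4 = h.2)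
    (r11 : τ.reg 11 = m) :
    let τ' := (fun τ : MState => gensStep.run τ.tick)^[n] τ
    τ'.stk 0 = [] ∧ τ'.stk 6 = (encodeMons (L ++ A)).reverse ∧
      τ'.stk 2 = encodeMons (mergeSegs g h m A R) ∧ τ'.stk 3 = [] ∧ τ'.stk 4 = [] ∧
      τ'.stk 5 = [] ∧ τ'.steps ≤ τ.steps + n * (20 + 64 * (B + m)) := by
  induction n generalizing A L R τ with
  | zero =>
    obtain rfl : A = [] := List.eq_nil_of_length_eq_zero (by omega)
    simpa [mergeSegs] using ⟨h0, h6, h2, h3, h4, h5⟩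
  | succ n ih =>
    simp only [Function.iterate_succ_apply]
    have freg : ∀ r, r ∉ gensStep.regs → (gensStep.run τ.tick).reg r = τ.reg r :=
      fun r hr => run_reg_of_notMem hr _
    match A with
    | [] =>
      have hrun : gensStep.run τ.tick = (((τ.tick.setReg 16 0).tick.setReg 18 1).tick.tick.setReg
          18 1).tick := by
        simp [gensStep, Prog.run, h0]
      have := ih [] L R (gensStep.run τ.tick) (by simp) hB
        (by simp [hrun, h0]) (by simp [hrun, h6]) (by simp [hrun, h2]) (by simp [hrun, h3])
        (by simp [hrun, h4]) (by simp [hrun, h5])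
        (by rw [freg 1 (by decide), r1]) (by rw [freg 2 (by decide), r2])
        (by rw [freg 3 (by decide), r3]) (by rw [freg 4 (by decide), r4])
        (by rw [freg 11 (by decide), r11])
      obtain ⟨i0, i6, i2, i3, i4, i5, is⟩ := this
      refine ⟨i0, i6, i2, i3, i4, i5, is.trans ?_⟩
      have hs : (gensStep.run τ.tick).steps = τ.steps + 5 := by simp [hrun]
      rw [hs, Nat.succ_mul n]
      omega
    | q :: A =>
      set υ := (Prog.seq (.pop 5 0) (.seq (.pop 6 0) (.seq (.push 6 5) (.push 6 6)))).run
        (((Prog.seq (.len 16 0) (.const 18 1)).run τ.tick).tick) with hυ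
      have hrun : gensStep.run τ.tick = addSegProg.run υ := by
        simp [hυ, gensStep, Prog.run, h0]
      have u0 : υ.stk 0 = encodeMons A := by simp [hυ, Prog.run, h0]
      have u6 : υ.stk 6 = (encodeMons (L ++ [q])).reverse := by simp [hυ, Prog.run, h0, h6]
      have u2 : υ.stk 2 = encodeMons R := by simp [hυ, Prog.run, h2]
      have u3 : υ.stk 3 = [] := by simp [hυ, Prog.run, h3]
      have u4 : υ.stk 4 = [] := by simp [hυ, Prog.run, h4]
      have u5 : υ.stk 5 = [] := by simp [hυ, Prog.run, h5]
      have us : υ.steps = τ.steps + 8 := by simp [hυ, Prog.run]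
      obtain ⟨j2, j3, j4, j5, js⟩ := addSegProg_run υ g h q m R u2 u3 u4 u5
        (by simp [hυ, Prog.run, r1]) (by simp [hυ, Prog.run, r2]) (by simp [hυ, Prog.run, r3])
        (by simp [hυ, Prog.run, r4]) (by simp [hυ, Prog.run, h0]) (by simp [hυ, Prog.run, h0])
        (by simp [hυ, Prog.run, r11])
      rw [← hrun] at j2 j3 j4 j5 js
      have hl : (segList g h q m).length = m := by simp [segList]
      rw [List.length_cons, Nat.succ_mul] at hB
      have := ih A (L ++ [q]) (R.merge (segList g h q m) lexLe) (gensStep.run τ.tick)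
        (by simpa using hn) (by rw [List.length_merge, hl]; omega)
        (by rw [hrun, run_stk_of_notMem (by decide), u0])
        (by rw [hrun, run_stk_of_notMem (by decide), u6]) j2 j3 j4 j5
        (by rw [freg 1 (by decide), r1]) (by rw [freg 2 (by decide), r2])
        (by rw [freg 3 (by decide), r3]) (by rw [freg 4 (by decide), r4])
        (by rw [freg 11 (by decide), r11])
      obtain ⟨i0, i6, i2, i3, i4, i5, is⟩ := this
      rw [List.append_assoc, List.singleton_append] at i6
      refine ⟨i0, i6, i2, i3, i4, i5, is.trans ?_⟩
      rw [Nat.succ_mul n]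
      omega

/-- Run `gensStep` over all of stack `0`, and restore the stack. -/
def gensProg : Prog := .seq (.len 9 0) (.seq (.loop 9 gensStep) (moveProg 6 0))

lemma gensProg_run (g h : ℕ × ℕ) (m B : ℕ) (G R : List (ℕ × ℕ)) (τ : MState)
    (hB : R.length + G.length * m ≤ B)
    (h0 : τ.stk 0 = encodeMons G) (h6 : τ.stk 6 = [])
    (h2 : τ.stk 2 = encodeMons R) (h3 : τ.stk 3 = []) (h4 : τ.stk 4 = []) (h5 : τ.stk 5 = [])
    (r1 : τ.reg 1 = g.1) (r2 : τ.reg 2 = g.2) (r3 : τ.reg 3 = h.1) (r4 : τ.reg 4 = h.2)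
    (r11 : τ.reg 11 = m) :
    let τ' := gensProg.run τ
    τ'.stk 0 = encodeMons G ∧ τ'.stk 6 = [] ∧
      τ'.stk 2 = encodeMons (mergeSegs g h m G R) ∧ τ'.stk 3 = [] ∧ τ'.stk 4 = [] ∧
      τ'.stk 5 = [] ∧ τ'.steps ≤ τ.steps + (G.length + 1) * (50 + 128 * (B + m)) := by
  set υ := (Prog.len 9 0).run τ with hυ
  have u9 : υ.reg 9 = 2 * G.length := by simp [hυ, Prog.run, h0]
  obtain ⟨i0, i6, i2, i3, i4, i5, is⟩ := gensStep_iterate (υ.reg 9) g h m B G [] R υ.tick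
    (by omega) hB h0 h6 h2 h3 h4 h5
    (by simp [hυ, Prog.run, r1]) (by simp [hυ, Prog.run, r2]) (by simp [hυ, Prog.run, r3])
    (by simp [hυ, Prog.run, r4]) (by simp [hυ, Prog.run, r11])
  set φ := (Prog.loop 9 gensStep).run υ with hφ
  change φ.stk 0 = _ at i0
  change φ.stk 6 = _ at i6
  change φ.stk 2 = _ at i2
  change φ.stk 3 = _ at i3
  change φ.stk 4 = _ at i4
  change φ.stk 5 = _ at i5
  change φ.steps ≤ _ at is
  have hrun : gensProg.run τ = (moveProg 6 0).run φ := rfl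
  obtain ⟨j6, j0⟩ := moveProg_stk (a := 6) (b := 0) (by decide) φ
  have js := moveProg_steps 6 0 φ
  rw [i0, i6, List.reverse_reverse, List.append_nil, List.nil_append] at j0
  rw [i6, List.length_reverse, List.nil_append, length_encodeMons] at js
  have us : υ.tick.steps = τ.steps + 2 := rfl
  simp only [hrun]
  refine ⟨j0, j6, ?_, ?_, ?_, ?_, ?_⟩
  · rw [run_stk_of_notMem (by decide), i2]
  · rw [run_stk_of_notMem (by decide), i3]
  · rw [run_stk_of_notMem (by decide), i4]
  · rw [run_stk_of_notMem (by decide), i5]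
  · rw [u9] at is
    nlinarith

/-- Merge into `R` the segments between consecutive elements of `g :: P` shifted by the elements
of `G`. -/
def mergeAll (m : ℕ) (G : List (ℕ × ℕ)) : ℕ × ℕ → List (ℕ × ℕ) → List (ℕ × ℕ) → List (ℕ × ℕ)
  | _, [], R => R
  | g, h :: P, R => mergeAll m G h P (mergeSegs g h m G R)

lemma length_mergeAll (m : ℕ) (G : List (ℕ × ℕ)) (g : ℕ × ℕ) (P R : List (ℕ × ℕ)) :
    (mergeAll m G g P R).length = R.length + P.length * (G.length * m) := by
  induction P generalizing g R with
  | nil => simp [mergeAll]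
  | cons h P ih =>
    rw [mergeAll, ih, length_mergeSegs, List.length_cons]
    ring

/-- Process one element of stack `1`. -/
def pairsStep : Prog :=
  .seq (.len 16 1) (.seq (.const 18 1) (.ifLe 18 16
    (.seq (.seq (.pop 3 1) (.pop 4 1)) (.seq gensProg (.seq (.copy 1 3) (.copy 2 4))))
    (.const 18 1)))

/-- Registers `1, 2` carry the previous element of `P`, so that each popped element closes one
consecutive pair and opens the next. -/
lemma pairsStep_iterate (n : ℕ) (g : ℕ × ℕ) (m B : ℕ) (P G R : List (ℕ × ℕ)) (τ : MState)
    (hn : P.length ≤ n) (hB : R.length + P.length * (G.length * m) ≤ B)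
    (h0 : τ.stk 0 = encodeMons G) (h1 : τ.stk 1 = encodeMons P) (h6 : τ.stk 6 = [])
    (h2 : τ.stk 2 = encodeMons R) (h3 : τ.stk 3 = []) (h4 : τ.stk 4 = []) (h5 : τ.stk 5 = [])
    (r1 : τ.reg 1 = g.1) (r2 : τ.reg 2 = g.2) (r11 : τ.reg 11 = m) :
    let τ' := (fun τ : MState => pairsStep.run τ.tick)^[n] τ
    τ'.stk 0 = encodeMons G ∧ τ'.stk 2 = encodeMons (mergeAll m G g P R) ∧ τ'.stk 5 = [] ∧
      τ'.steps ≤ τ.steps + n * ((G.length + 1) * (60 + 128 * (B + m))) := by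
  induction n generalizing P R g τ with
  | zero =>
    obtain rfl : P = [] := List.eq_nil_of_length_eq_zero (by omega)
    simpa [mergeAll] using ⟨h0, h2, h5⟩
  | succ n ih =>
    simp only [Function.iterate_succ_apply]
    have hcost : 10 + (G.length + 1) * (50 + 128 * (B + m)) ≤
        (G.length + 1) * (60 + 128 * (B + m)) := by
      nlinarith
    match P with
    | [] =>
      have hrun : pairsStep.run τ.tick = (((τ.tick.setReg 16 0).tick.setReg 18 1).tick.tick.setReg
          18 1).tick := by
        simp [pairsStep, Prog.run, h1]
      obtain ⟨i0, i2, i5, is⟩ := ih g [] R (pairsStep.run τ.tick) (by simp) hB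
        (by simp [hrun, h0]) (by simp [hrun, h1]) (by simp [hrun, h6]) (by simp [hrun, h2])
        (by simp [hrun, h3]) (by simp [hrun, h4]) (by simp [hrun, h5])
        (by simp [hrun, r1]) (by simp [hrun, r2]) (by simp [hrun, r11])
      refine ⟨i0, i2, i5, is.trans ?_⟩
      have hs : (pairsStep.run τ.tick).steps = τ.steps + 5 := by simp [hrun]
      rw [hs, Nat.succ_mul n]
      omega
    | h :: P =>
      set υ := (Prog.seq (.pop 3 1) (.pop 4 1)).run
        (((Prog.seq (.len 16 1) (.const 18 1)).run τ.tick).tick) with hυ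
      have hrun : pairsStep.run τ.tick = (Prog.seq (.copy 1 3) (.copy 2 4)).run
          (gensProg.run υ) := by
        simp [hυ, pairsStep, Prog.run, h1]
      have u1 : υ.stk 1 = encodeMons P := by simp [hυ, Prog.run, h1]
      have u3 : υ.reg 3 = h.1 := by simp [hυ, Prog.run, h1]
      have u4 : υ.reg 4 = h.2 := by simp [hυ, Prog.run, h1]
      have u11 : υ.reg 11 = m := by simp [hυ, Prog.run, r11]
      have us : υ.steps = τ.steps + 6 := by simp [hυ, Prog.run]
      rw [List.length_cons, Nat.succ_mul] at hB
      obtain ⟨j0, j6, j2, j3, j4, j5, js⟩ := gensProg_run g h m B G R υ (by omega)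
        (by simp [hυ, Prog.run, h0]) (by simp [hυ, Prog.run, h6]) (by simp [hυ, Prog.run, h2])
        (by simp [hυ, Prog.run, h3]) (by simp [hυ, Prog.run, h4]) (by simp [hυ, Prog.run, h5])
        (by simp [hυ, Prog.run, r1]) (by simp [hυ, Prog.run, r2]) u3 u4 u11
      have j1 : (gensProg.run υ).stk 1 = encodeMons P := by
        rw [run_stk_of_notMem (by decide), u1]
      have k3 : (gensProg.run υ).reg 3 = h.1 := by rw [run_reg_of_notMem (by decide), u3]
      have k4 : (gensProg.run υ).reg 4 = h.2 := by rw [run_reg_of_notMem (by decide), u4]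
      have k11 : (gensProg.run υ).reg 11 = m := by rw [run_reg_of_notMem (by decide), u11]
      generalize gensProg.run υ = φ at *
      obtain ⟨i0, i2, i5, is⟩ := ih h P (mergeSegs g h m G R) (pairsStep.run τ.tick)
        (by simpa using hn) (by rw [length_mergeSegs]; omega)
        (by simp [hrun, Prog.run, j0]) (by simp [hrun, Prog.run, j1])
        (by simp [hrun, Prog.run, j6]) (by simp [hrun, Prog.run, j2])
        (by simp [hrun, Prog.run, j3]) (by simp [hrun, Prog.run, j4])
        (by simp [hrun, Prog.run, j5]) (by simp [hrun, Prog.run, k3])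
        (by simp [hrun, Prog.run, k4]) (by simp [hrun, Prog.run, k11])
      refine ⟨i0, i2, i5, is.trans ?_⟩
      have hs : (pairsStep.run τ.tick).steps = φ.steps + 2 := by simp [hrun, Prog.run]
      rw [hs, Nat.succ_mul n]
      omega

/-! ### Extraction of the minimal elements and the whole program -/

/-- The elements of a list whose `y`-degree is less than `b` and than all earlier `y`-degrees. -/
def skyline : ℕ → List (ℕ × ℕ) → List (ℕ × ℕ)
  | _, [] => []
  | b, a :: A => if b ≤ a.2 then skyline b A else a :: skyline a.2 A

lemma length_skyline_le (b : ℕ) (A : List (ℕ × ℕ)) : (skyline b A).length ≤ A.length := by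
  induction A generalizing b with
  | nil => rfl
  | cons a A ih =>
    rw [skyline]
    split_ifs
    · exact (ih b).trans (Nat.le_succ _)
    · exact Nat.succ_le_succ (ih a.2)

/-- Process one element of stack `2` while computing the skyline. -/
def skylineStep : Prog :=
  .seq (.len 16 2) (.seq (.const 18 1) (.ifLe 18 16
    (.seq (.pop 9 2) (.seq (.pop 10 2) (.ifLe 12 10 (.const 18 1)
      (.seq (.push 5 9) (.seq (.push 5 10) (.copy 12 10))))))
    (.const 18 1)))

lemma skylineStep_iterate (n b : ℕ) (A L : List (ℕ × ℕ)) (τ : MState)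
    (hn : A.length ≤ n) (h2 : τ.stk 2 = encodeMons A) (h5 : τ.stk 5 = (encodeMons L).reverse)
    (r12 : τ.reg 12 = b) :
    ((fun τ : MState => skylineStep.run τ.tick)^[n] τ).stk 5 =
      (encodeMons (L ++ skyline b A)).reverse := by
  induction n generalizing A L b τ with
  | zero =>
    obtain rfl : A = [] := List.eq_nil_of_length_eq_zero (by omega)
    simpa [skyline] using h5
  | succ n ih =>
    simp only [Function.iterate_succ_apply]
    match A with
    | [] =>
      exact ih b [] L (skylineStep.run τ.tick) (by simp)
        (by simp [skylineStep, Prog.run, h2]) (by simp [skylineStep, Prog.run, h2, h5])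
        (by simp [skylineStep, Prog.run, h2, r12])
    | a :: A =>
      by_cases hb : b ≤ a.2
      · rw [skyline, if_pos hb]
        exact ih b A L (skylineStep.run τ.tick) (by simpa using hn)
          (by simp [skylineStep, Prog.run, h2, r12, hb])
          (by simp [skylineStep, Prog.run, h2, h5, r12, hb])
          (by simp [skylineStep, Prog.run, h2, r12, hb])
      · rw [skyline, if_neg hb]
        have := ih a.2 A (L ++ [a]) (skylineStep.run τ.tick) (by simpa using hn)
          (by simp [skylineStep, Prog.run, h2, r12, hb])
          (by simp [skylineStep, Prog.run, h2, h5, r12, hb])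
          (by simp [skylineStep, Prog.run, h2, r12, hb])
        rwa [List.append_assoc, List.singleton_append] at this

/-- Empty stack `0`. -/
def clearProg : Prog := .seq (.len 9 0) (.loop 9 (.pop 10 0))

lemma clearProg_run (σ : MState) :
    (clearProg.run σ).stk 0 = [] ∧
      (clearProg.run σ).steps ≤ σ.steps + 2 + 2 * (σ.stk 0).length := by
  have e : ((Prog.len 9 0).run σ).reg 9 = (σ.stk 0).length := by simp [Prog.run]
  constructor
  · have key := run_loop_induct (a := 9) (p := .pop 10 0) (σ := (Prog.len 9 0).run σ)
      (fun n τ => τ.stk 0 = (σ.stk 0).drop n) (by simp [Prog.run])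
      (fun n _ τ hτ => by simp [Prog.run, hτ])
    rw [e, List.drop_length] at key
    exact key
  · have := run_loop_steps_le (p := .pop 10 0) rfl 9 ((Prog.len 9 0).run σ)
    rw [e] at this
    have hs : ((Prog.len 9 0).run σ).steps = σ.steps + 1 := rfl
    have hc : (Prog.pop 10 0).cost = 1 := rfl
    have hrun : clearProg.run σ = (Prog.loop 9 (.pop 10 0)).run ((Prog.len 9 0).run σ) := rfl
    rw [hs, hc] at this
    rw [hrun]
    omega

/-- Replace stack `0` by the skyline of stack `2`. -/
def outputProg : Prog :=
  .seq (.seq (.pop 9 2) (.seq (.pop 10 2) (.seq (.push 5 9) (.seq (.push 5 10)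
    (.seq (.copy 12 10) (.len 13 2))))))
    (.seq (.loop 13 skylineStep) (.seq clearProg (moveProg 5 0)))

lemma outputProg_run (σ : MState) (a : ℕ × ℕ) (A G : List (ℕ × ℕ))
    (h0 : σ.stk 0 = encodeMons G) (h2 : σ.stk 2 = encodeMons (a :: A)) (h5 : σ.stk 5 = []) :
    (outputProg.run σ).stk 0 = encodeMons (a :: skyline a.2 A) ∧
      (outputProg.run σ).steps ≤ σ.steps + 20 + 4 * G.length + 30 * A.length := by
  set τ := (Prog.seq (.pop 9 2) (.seq (.pop 10 2) (.seq (.push 5 9) (.seq (.push 5 10)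
    (.seq (.copy 12 10) (.len 13 2)))))).run σ with hτ
  have t13 : τ.reg 13 = 2 * A.length := by simp [hτ, Prog.run, h2]
  have ts : τ.steps = σ.steps + 6 := rfl
  have k5 := skylineStep_iterate (τ.reg 13) a.2 A [a] τ.tick (by omega)
    (by simp [hτ, Prog.run, h2]) (by simp [hτ, Prog.run, h2, h5]) (by simp [hτ, Prog.run, h2])
  have ks := run_loop_steps_le (p := skylineStep) rfl 13 τ
  have k0 : ((Prog.loop 13 skylineStep).run τ).stk 0 = encodeMons G := by
    rw [run_stk_of_notMem (by decide)]
    simp [hτ, Prog.run, h0]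
  have hrun : outputProg.run σ =
    (moveProg 5 0).run (clearProg.run ((Prog.loop 13 skylineStep).run τ)) := rfl
  change ((Prog.loop 13 skylineStep).run τ).stk 5 = _ at k5
  generalize (Prog.loop 13 skylineStep).run τ = υ at *
  obtain ⟨c0, cs⟩ := clearProg_run υ
  have c5 : (clearProg.run υ).stk 5 = υ.stk 5 := run_stk_of_notMem (by decide) _
  obtain ⟨-, m0⟩ := moveProg_stk (a := 5) (b := 0) (by decide) (clearProg.run υ)
  have ms := moveProg_steps 5 0 (clearProg.run υ)
  rw [c0, c5, k5, List.reverse_reverse, List.append_nil] at m0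
  rw [c5, k5, List.length_reverse, length_encodeMons, List.length_append] at ms
  rw [k0, length_encodeMons] at cs
  have hc : skylineStep.cost = 9 := rfl
  have hl := length_skyline_le a.2 A
  rw [t13, hc] at ks
  rw [hrun]
  refine ⟨m0, ?_⟩
  simp only [List.length_singleton] at ms
  omega

/-- The program that computes the generators of `I ^ (s + ℓ)` from those of `I ^ s`. -/
def powerProg : Prog :=
  -- Register `24` is still zero, so the test asks whether `ℓ = 0`. In that case the input is
  -- already the output and no addition is permitted.
  .ifLe 0 24 (.const 9 0)
    (.seq (.seq (.const 11 1) (.seq (.add 11 0 11) (.seq (.pop 1 1) (.seq (.pop 2 1)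
      (.len 13 1)))))
      (.seq (.loop 13 pairsStep) outputProg))

lemma powerProg_run_zero (G P : List (ℕ × ℕ)) :
    (powerProg.run (initState G P 0)).stk 0 = encodeMons G ∧
      (powerProg.run (initState G P 0)).adds = 0 ∧
      (powerProg.run (initState G P 0)).steps = 2 := by
  simp [powerProg, Prog.run, initState]

/-- The merged list has `P.length * G.length * (ℓ + 1)` entries, and the number of merges depends on
`P` and `G` only; the bound is therefore affine in `ℓ`. -/
lemma powerProg_run (G P : List (ℕ × ℕ)) (g : ℕ × ℕ) {ℓ : ℕ} (hℓ : 0 < ℓ) (a : ℕ × ℕ)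
    (A : List (ℕ × ℕ)) (hA : mergeAll (ℓ + 1) G g P [] = a :: A) :
    (powerProg.run (initState G (g :: P) ℓ)).stk 0 = encodeMons (a :: skyline a.2 A) ∧
      (powerProg.run (initState G (g :: P) ℓ)).steps ≤ 30 + 4 * G.length +
        30 * (P.length * (G.length * (ℓ + 1))) + 2 * P.length * ((G.length + 1) *
          (60 + 128 * (P.length * (G.length * (ℓ + 1)) + (ℓ + 1)))) := by
  set τ := (Prog.seq (.const 11 1) (.seq (.add 11 0 11) (.seq (.pop 1 1) (.seq (.pop 2 1)
      (.len 13 1))))).run (initState G (g :: P) ℓ).tick with hτ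
  have hrun : powerProg.run (initState G (g :: P) ℓ) =
      outputProg.run ((Prog.loop 13 pairsStep).run τ) := by
    have : ¬ (initState G (g :: P) ℓ).reg 0 ≤ (initState G (g :: P) ℓ).reg 24 := by
      simp [initState]
      omega
    rw [powerProg, Prog.run, if_neg this]
    rfl
  have t13 : τ.reg 13 = 2 * P.length := by simp [hτ, Prog.run, initState]
  have ts : τ.tick.steps = 7 := rfl
  obtain ⟨i0, i2, i5, is⟩ := pairsStep_iterate (τ.reg 13) g (ℓ + 1) _ P G [] τ.tick (by omega) le_rfl
    (by simp [hτ, Prog.run, initState]) (by simp [hτ, Prog.run, initState])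
    (by simp [hτ, Prog.run, initState]) (by simp [hτ, Prog.run, initState])
    (by simp [hτ, Prog.run, initState]) (by simp [hτ, Prog.run, initState])
    (by simp [hτ, Prog.run, initState]) (by simp [hτ, Prog.run, initState])
    (by simp [hτ, Prog.run, initState]) (by simp [hτ, Prog.run, initState])
  have ks : ((Prog.loop 13 pairsStep).run τ).steps ≤ _ := is
  change ((Prog.loop 13 pairsStep).run τ).stk 0 = _ at i0
  change ((Prog.loop 13 pairsStep).run τ).stk 2 = _ at i2
  change ((Prog.loop 13 pairsStep).run τ).stk 5 = _ at i5
  rw [hA] at i2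
  obtain ⟨o0, os⟩ := outputProg_run _ a A G i0 i2 i5
  have hlen := length_mergeAll (ℓ + 1) G g P []
  rw [hA, List.length_cons, List.length_nil, zero_add] at hlen
  rw [t13, ts, List.length_nil, zero_add] at ks
  rw [hrun]
  refine ⟨o0, ?_⟩
  omega

end Programs

/-! ### Sortedness of the merged list and correctness of the skyline -/

section Correctness

lemma lexLe_iff {a b : ℕ × ℕ} : lexLe a b = true ↔ a.1 < b.1 ∨ a.1 = b.1 ∧ a.2 ≤ b.2 :=
  decide_eq_true_iff

lemma pairwise_merge_lexLe {A B : List (ℕ × ℕ)} (hA : A.Pairwise fun a b => lexLe a b = true)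
    (hB : B.Pairwise fun a b => lexLe a b = true) :
    (A.merge B lexLe).Pairwise fun a b => lexLe a b = true := by
  refine List.pairwise_merge ?_ ?_ A B hA hB
  · intro a b c hab hbc
    rw [lexLe_iff] at *
    omega
  · intro a b
    rw [Bool.or_eq_true, lexLe_iff, lexLe_iff]
    omega

lemma mem_segList {g h q p : ℕ × ℕ} {ℓ : ℕ} :
    p ∈ segList g h q (ℓ + 1) ↔ ∃ j ≤ ℓ, j • g + (ℓ - j) • h + q = p := by
  simp [segList]

/-- Each step along the segment trades a factor `g` for a factor `h` of larger `x`-degree. -/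
lemma pairwise_segList {g h : ℕ × ℕ} (hgh : g.1 < h.1) (q : ℕ × ℕ) (m : ℕ) :
    (segList g h q m).Pairwise fun a b => lexLe a b = true := by
  rw [segList, List.pairwise_map, List.pairwise_reverse]
  refine List.pairwise_lt_range.imp_of_mem fun {i j} _ hj hij => ?_
  rw [List.mem_range] at hj
  rw [lexLe_iff]
  left
  simp only [Prod.fst_add, Prod.smul_fst, smul_eq_mul]
  obtain ⟨k, rfl⟩ := Nat.exists_eq_add_of_lt hij
  obtain ⟨d, hd⟩ : ∃ d, m - 1 - (i + k + 1) = d := ⟨_, rfl⟩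
  have hi : m - 1 - i = d + (k + 1) := by omega
  rw [hd, hi]
  have := Nat.mul_lt_mul_of_pos_left hgh (Nat.succ_pos k)
  simp only [Nat.succ_eq_add_one] at this
  linarith

lemma mem_mergeSegs {g h p : ℕ × ℕ} {m : ℕ} {G R : List (ℕ × ℕ)} :
    p ∈ mergeSegs g h m G R ↔ p ∈ R ∨ ∃ q ∈ G, p ∈ segList g h q m := by
  induction G generalizing R with
  | nil => simp [mergeSegs]
  | cons q G ih =>
    have := ih (R := R.merge (segList g h q m) lexLe)
    rw [List.mem_merge] at this
    refine this.trans ?_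
    simp [or_assoc]

lemma pairwise_mergeSegs {g h : ℕ × ℕ} (hgh : g.1 < h.1) (m : ℕ) (G : List (ℕ × ℕ))
    {R : List (ℕ × ℕ)} (hR : R.Pairwise fun a b => lexLe a b = true) :
    (mergeSegs g h m G R).Pairwise fun a b => lexLe a b = true := by
  induction G generalizing R with
  | nil => exact hR
  | cons q G ih => exact ih (pairwise_merge_lexLe hR (pairwise_segList hgh q m))

lemma mem_mergeAll {g p : ℕ × ℕ} {m : ℕ} {P G R : List (ℕ × ℕ)} :
    p ∈ mergeAll m G g P R ↔ p ∈ R ∨ ∃ (i : ℕ) (hi : i + 1 < (g :: P).length), ∃ q ∈ G,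
      p ∈ segList (g :: P)[i] (g :: P)[i + 1] q m := by
  induction P generalizing g R with
  | nil => simp [mergeAll]
  | cons h P ih =>
    rw [mergeAll, ih, mem_mergeSegs, or_assoc]
    refine or_congr_right ⟨?_, ?_⟩
    · rintro (⟨q, hq, hp⟩ | ⟨i, hi, q, hq, hp⟩)
      · exact ⟨0, by simp, q, hq, hp⟩
      · exact ⟨i + 1, by simpa using hi, q, hq, hp⟩
    · rintro ⟨i, hi, q, hq, hp⟩
      match i with
      | 0 => exact Or.inl ⟨q, hq, hp⟩
      | i + 1 => exact Or.inr ⟨i, by simpa using hi, q, hq, hp⟩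

lemma pairwise_mergeAll {g : ℕ × ℕ} {P : List (ℕ × ℕ)}
    (hP : (g :: P).Pairwise fun a b => a.1 < b.1) (m : ℕ) (G : List (ℕ × ℕ))
    {R : List (ℕ × ℕ)} (hR : R.Pairwise fun a b => lexLe a b = true) :
    (mergeAll m G g P R).Pairwise fun a b => lexLe a b = true := by
  induction P generalizing g R with
  | nil => exact hR
  | cons h P ih =>
    rw [List.pairwise_cons] at hP
    exact ih hP.2 (pairwise_mergeSegs (hP.1 h List.mem_cons_self) m G hR)

lemma skyline_sublist (b : ℕ) (A : List (ℕ × ℕ)) : (skyline b A).Sublist A := by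
  induction A generalizing b with
  | nil => exact List.Sublist.refl _
  | cons a A ih =>
    rw [skyline]
    split_ifs
    · exact (ih b).cons a
    · exact (ih a.2).cons_cons a

lemma snd_lt_of_mem_skyline {b : ℕ} {A : List (ℕ × ℕ)} {p : ℕ × ℕ} (hp : p ∈ skyline b A) :
    p.2 < b := by
  induction A generalizing b with
  | nil => simp [skyline] at hp
  | cons a A ih =>
    rw [skyline] at hp
    split_ifs at hp with h
    · exact ih hp
    · rcases List.mem_cons.1 hp with rfl | hp
      · exact not_le.1 h
      · exact (ih hp).trans (not_le.1 h)

lemma descY_skyline (b : ℕ) (A : List (ℕ × ℕ)) : DescY (skyline b A) := by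
  induction A generalizing b with
  | nil => exact List.Pairwise.nil
  | cons a A ih =>
    rw [skyline]
    split_ifs
    · exact ih b
    · exact List.pairwise_cons.2 ⟨fun p hp => snd_lt_of_mem_skyline hp, ih a.2⟩

/-- An entry is discarded only if an earlier record has at most its `y`-degree, and sortedness gives
that record at most its `x`-degree, so the record divides it. -/
lemma exists_mem_skyline_le {b : ℕ} {A : List (ℕ × ℕ)}
    (hA : A.Pairwise fun a b => lexLe a b = true) {p : ℕ × ℕ} (hp : p ∈ A) (hpb : p.2 < b) :
    ∃ d ∈ skyline b A, d ≤ p := by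
  induction A generalizing b with
  | nil => simp at hp
  | cons a A ih =>
    rw [List.pairwise_cons] at hA
    rw [skyline]
    split_ifs with h
    · rcases List.mem_cons.1 hp with rfl | hp
      · omega
      · exact ih hA.2 hp hpb
    · by_cases hap : a.2 ≤ p.2
      · refine ⟨a, List.mem_cons_self, ?_, hap⟩
        rcases List.mem_cons.1 hp with rfl | hp
        · exact le_rfl
        · have := lexLe_iff.1 (hA.1 p hp)
          omega
      · rcases List.mem_cons.1 hp with rfl | hp
        · exact absurd le_rfl hap
        · obtain ⟨d, hd, hdp⟩ := ih hA.2 hp (not_le.1 hap)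
          exact ⟨d, List.mem_cons_of_mem _ hd, hdp⟩

/-- The skyline of a lexicographically sorted list consists of the minimal elements of the upper
set that the list generates. -/
lemma mem_skyline_iff_minimal {b : ℕ} {A : List (ℕ × ℕ)}
    (hA : A.Pairwise fun a b => lexLe a b = true) (hb : ∀ a ∈ A, a.2 < b) (p : ℕ × ℕ) :
    p ∈ skyline b A ↔ Minimal (fun x => ∃ c ∈ A, c ≤ x) p := by
  -- Along the skyline `y` strictly falls; equal `x`-degrees would contradict the lexicographic
  -- order, so `x` strictly rises and no entry divides another.
  have hanti : (skyline b A).Pairwise fun a b => a.1 < b.1 ∧ b.2 < a.2 := by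
    refine ((hA.sublist (skyline_sublist b A)).and (descY_skyline b A)).imp ?_
    rintro a b ⟨h1, h2⟩
    rw [lexLe_iff] at h1
    omega
  have heq : ∀ d ∈ skyline b A, ∀ p ∈ skyline b A, d ≤ p → d = p := by
    intro d hd p hp hdp
    obtain ⟨i, hi, rfl⟩ := List.mem_iff_getElem.1 hd
    obtain ⟨j, hj, rfl⟩ := List.mem_iff_getElem.1 hp
    rw [List.pairwise_iff_getElem] at hanti
    rcases lt_trichotomy i j with hij | rfl | hij
    · exact absurd hdp.2 (not_le.2 (hanti i j hi hj hij).2)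
    · rfl
    · exact absurd hdp.1 (not_le.2 (hanti j i hj hi hij).1)
  constructor
  · intro hp
    refine ⟨⟨p, (skyline_sublist b A).subset hp, le_rfl⟩, ?_⟩
    rintro x ⟨c, hc, hcx⟩ hxp
    obtain ⟨d, hd, hdc⟩ := exists_mem_skyline_le hA hc (hb c hc)
    rw [← heq d hd p hp (hdc.trans (hcx.trans hxp))]
    exact hdc.trans hcx
  · rintro ⟨⟨c, hc, hcp⟩, hmin⟩
    obtain ⟨d, hd, hdc⟩ := exists_mem_skyline_le hA hc (hb c hc)
    have := hmin ⟨d, (skyline_sublist b A).subset hd, le_rfl⟩ (hdc.trans hcp)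
    rwa [le_antisymm this (hdc.trans hcp)]

/-- The program outputs the first monomial unconditionally; this amounts to starting the sweep with
a bound above all `y`-degrees. -/
lemma exists_skyline_eq {a : ℕ × ℕ} {A : List (ℕ × ℕ)} :
    ∃ b, (∀ c ∈ a :: A, c.2 < b) ∧ skyline b (a :: A) = a :: skyline a.2 A := by
  obtain ⟨b, hb⟩ : ∃ b, ∀ c ∈ a :: A, c.2 < b := by
    refine ⟨((a :: A).map Prod.snd).foldr max 0 + 1, fun c hc => Nat.lt_succ_of_le ?_⟩
    exact le_foldr_max (List.mem_map_of_mem hc)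
  refine ⟨b, hb, ?_⟩
  rw [skyline, if_neg (not_le.2 (hb a List.mem_cons_self))]

end Correctness

/-! ### Assembly -/

theorem corollary5 :
    ∃ Q : Prog, ∀ (K : Type u) [Field K] (I : Ideal (Poly2 K)),
      IsMonomialIdeal I → ¬ Submodule.IsPrincipal I →
      ∀ P : List (ℕ × ℕ), DescY P →
      (∀ p ∈ persistentGens I, p ∈ P) → (∀ p ∈ P, p ∈ weaklyPersistentGens I) →
      ∀ s : ℕ, bigD I P + rMin I P (bigD I P) + 1 ≤ s →
      ∀ G : List (ℕ × ℕ), ListsMingens G (I ^ s) →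
      ∃ C : ℕ, ∀ ℓ : ℕ, ∃ G' : List (ℕ × ℕ),
        ListsMingens G' (I ^ (s + ℓ)) ∧
        (Q.run (initState G P ℓ)).stk 0 = encodeMons G' ∧
        (Q.run (initState G P ℓ)).adds ≤ C * ℓ ∧
        (Q.run (initState G P ℓ)).steps ≤ C * (ℓ + 1) := by
  refine ⟨powerProg, fun K _ I hI hprin P hP hper hweak s hs G hG => ?_⟩
  have hlen := two_le_length hI hprin hper hweak
  obtain ⟨g, P, rfl⟩ : ∃ g P', P = g :: P' := by
    cases P with
    | nil => simp at hlen
    | cons g P => exact ⟨g, P, rfl⟩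
  set k := P.length
  set n := G.length
  -- The step bound of `powerProg_run` with every occurrence of `ℓ + 1` replaced by `1`; the full
  -- bound is at most `c * (ℓ + 1)`.
  set c := 30 + 4 * n + 30 * (k * n) + 2 * k * ((n + 1) * (60 + 128 * (k * n + 1))) with hc
  -- Every addition is a step, and `c * (ℓ + 1) ≤ 2 * c * ℓ` for `ℓ ≥ 1`; hence the factor `2` and
  -- the separate treatment of `ℓ = 0`.
  refine ⟨2 * c, fun ℓ => ?_⟩
  rcases Nat.eq_zero_or_pos ℓ with rfl | hℓ
  · obtain ⟨h0, ha, hst⟩ := powerProg_run_zero G (g :: P)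
    refine ⟨G, by simpa using hG, h0, by omega, by omega⟩
  have hx : (g :: P).Pairwise fun a b => a.1 < b.1 := by
    refine hP.imp_of_mem fun ha hb hab => ?_
    exact fst_lt_of_snd_lt (hweak _ ha).1 (hweak _ hb).1 hab
  have hsorted := pairwise_mergeAll hx (ℓ + 1) G
    (List.Pairwise.nil (R := fun a b => lexLe a b = true))
  have hmem : ∀ p, mon K p ∈ I ^ (s + ℓ) ↔ ∃ a ∈ mergeAll (ℓ + 1) G g P [], a ≤ p := by
    intro p
    rw [mon_mem_pow_add_iff hP hI hprin hper hweak (by omega) ℓ p]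
    constructor
    · rintro ⟨i, hi, q, hq, j, hj, hle⟩
      exact ⟨_, mem_mergeAll.2 (Or.inr ⟨i, hi, q, (hG.2 q).2 hq, mem_segList.2 ⟨j, hj, rfl⟩⟩), hle⟩
    · rintro ⟨a, ha, hle⟩
      rcases mem_mergeAll.1 ha with h | ⟨i, hi, q, hq, hseg⟩
      · simp at h
      · obtain ⟨j, hj, rfl⟩ := mem_segList.1 hseg
        exact ⟨i, hi, q, (hG.2 q).1 hq, j, hj, hle⟩
  -- The list is nonempty because `I`, not being principal, contains a monomial and hence so does `I
  -- ^ (s + ℓ)`.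
  obtain ⟨a, A, hA⟩ : ∃ a A, mergeAll (ℓ + 1) G g P [] = a :: A := by
    cases hA : mergeAll (ℓ + 1) G g P [] with
    | cons a A => exact ⟨a, A, rfl⟩
    | nil =>
      obtain ⟨p, hp⟩ := exists_mon_mem hI hprin
      have hpow : mon K ((s + ℓ) • p) ∈ I ^ (s + ℓ) := by
        rw [mon_nsmul]
        exact Ideal.pow_mem_pow hp _
      obtain ⟨a, ha, -⟩ := (hmem _).1 hpow
      simp [hA] at ha
  obtain ⟨h0, hst⟩ := powerProg_run G P g hℓ a A hA
  rw [hA] at hsorted hmem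
  obtain ⟨b, hb, hsky⟩ := exists_skyline_eq (a := a) (A := A)
  have hadds := run_adds_le powerProg (initState G (g :: P) ℓ)
  have hinit : (initState G (g :: P) ℓ).adds = 0 ∧ (initState G (g :: P) ℓ).steps = 0 :=
    ⟨rfl, rfl⟩
  have hbound : (powerProg.run (initState G (g :: P) ℓ)).steps ≤ c * (ℓ + 1) := by
    refine hst.trans ?_
    change 30 + 4 * n + 30 * (k * (n * (ℓ + 1))) + 2 * k * ((n + 1) *
      (60 + 128 * (k * (n * (ℓ + 1)) + (ℓ + 1)))) ≤ _
    have h1 : 30 ≤ 30 * (ℓ + 1) := by omega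
    have h2 : 4 * n ≤ 4 * n * (ℓ + 1) := Nat.le_mul_of_pos_right _ (Nat.succ_pos ℓ)
    have h3 : 2 * k * ((n + 1) * (60 + 128 * (k * (n * (ℓ + 1)) + (ℓ + 1)))) ≤
        2 * k * ((n + 1) * ((60 + 128 * (k * n + 1)) * (ℓ + 1))) := by
      gcongr
      nlinarith
    calc _ ≤ 30 * (ℓ + 1) + 4 * n * (ℓ + 1) + 30 * (k * (n * (ℓ + 1))) +
          2 * k * ((n + 1) * ((60 + 128 * (k * n + 1)) * (ℓ + 1))) := by omega
      _ = c * (ℓ + 1) := by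
        rw [hc]
        ring
  refine ⟨a :: skyline a.2 A, ⟨?_, fun p => ?_⟩, h0, ?_, ?_⟩
  · rw [← hsky]
    exact descY_skyline b _
  · rw [← hsky, mem_skyline_iff_minimal hsorted hb]
    simp only [mingens, Set.mem_ofPred_eq, hmem]
  · nlinarith
  · nlinarith
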